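/- Let $\mathbb{N}_0=\{0,1,2,\ldots\}$. Fix integers $d_X,d_Y\ge 1$, reals $\alpha,\beta\in(0,1)$ with $\alpha+\beta<1$, and $A>0$. There is a constant $C>0$, depending only on $d_X,d_Y,\alpha,\beta,A$, with the following property. Let $(\mathcal X,\mu_X)$ and $(\mathcal Y,\mu_Y)$ be $\sigma$-finite measure spaces such that $L^2(\mu_X)$ and $L^2(\mu_Y)$ have orthonormal bases $(p^X_j)_{j\in\mathcal J}$ and $(p^Y_k)_{k\in\mathcal K}$ indexed by $\mathcal J=\mathbb{N}_0^{d_X}$ and $\mathcal K=\mathbb{N}_0^{d_Y}$, and let $\mu=\mu_X\otimes\mu_Y$. For a probability density $f\in L^2(\mu)$ (that is, $f\ge 0$ $\mu$-a.e. and $\int f\,d\mu=1$) with marginals $f_X(x)=\int f(x,y)\,d\mu_Y(y)$ and $f_Y(y)=\int f(x,y)\,d\mu_X(x)$ in $L^2(\mu_X)$ and $L^2(\mu_Y)$, put $$D(f)=\int (f(x,y)-f_X(x)f_Y(y))^2\,d\mu(x,y),\qquad S_\theta(f)=\sum_{j\in\mathcal J}\sum_{k\in\mathcal K}\theta_{jk}^2\,(a_{jk}-a_{j\bullet}a_{\bullet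 k})^2\in[0,\infty],$$ where $a_{jk}=\int f(x,y)\,p_j^X(x)p_k^Y(y)\,d\mu(x,y)$, $a_{j\bullet}=\int f_Xp_j^X\,d\mu_X$, $a_{\bullet k}=\int f_Yp_k^Y\,d\mu_Y$, $\theta=(\theta_{jk})\in[0,\infty]^{\mathcal J\times\mathcal K}$ and $\infty\cdot 0=0$. For $r>0$, $\xi=(\theta,r,A)$ and $\rho>0$ let $$\mathcal F_\xi(\rho)=\{f: D(f)\ge\rho^2,\ S_\theta(f)\le r^2,\ \max(\sup|f|,\sup|f_X|,\sup|f_Y|)\le A\}.$$ For $n\in\mathbb{N}$ let $\Psi(\alpha)$ be the set of measurable functions $\psi:(\mathcal X\times\mathcal Y)^n\to[0,1]$ such that $\mathbb{E}_P(\psi)\le\alpha$ for every distribution $P$ of a pair $(X,Y)$ with $X$ and $Y$ independent; here $\mathbb{E}_P(\psi)$ (or $\mathbb{E}_f(\psi)$ if $P$ has density $f$ with respect to $\mu$) is the expectation of $\psi$ evaluated at $n$ independent copies of $(X,Y)\sim P$. Let $$\rho^*(n,\alpha,\beta,\xi)=\inf\Big\{\rho>0:\ \inf_{\psi\in\Psi(\alpha)}\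 \sup_{f\in\mathcal F_\xi(\rho)}\mathbb{E}_f(1-\psi)\le\beta\Big\},$$ where the supremum is $0$ if $\mathcal F_\xi(\rho)=\emptyset$. Let $s_X,s_Y,r>0$ and let $\theta_{jk}=\max(\|j\|_1^{s_X},\|k\|_1^{s_Y})$ if $j\ne 0$ and $k\neq 0$, and $\theta_{jk}=\infty$ otherwise. If $n\ge 16$ and $nr^2\ge 1$, then $$\rho^*(n,\alpha,\beta,\xi)\le C\left(\frac{r^d}{n^{2s}}\right)^{1/(4s+d)},\qquad d=d_X+d_Y,\quad s=\frac{d}{d_X/s_X+d_Y/s_Y}.$$ -/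

import Mathlib

open MeasureTheory ProbabilityTheory
open scoped ENNReal

universe u v

namespace IndepTesting

noncomputable section

variable {𝒳 : Type u} {𝒴 : Type v} [MeasurableSpace 𝒳] [MeasurableSpace 𝒴]

/-- The marginal `f_X(x) = ∫ f(x, y) dμ_Y(y)`. -/
def marginalX (μY : Measure 𝒴) (f : 𝒳 × 𝒴 → ℝ) (x : 𝒳) : ℝ := ∫ y, f (x, y) ∂μY

/-- The marginal `f_Y(y) = ∫ f(x, y) dμ_X(x)`. -/
def marginalY (μX : Measure 𝒳) (f : 𝒳 × 𝒴 → ℝ) (y : 𝒴) : ℝ := ∫ x, f (x, y) ∂μX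

/-- The set `𝓕` of densities in `L²(μ)`, where `μ = μ_X ⊗ μ_Y`. -/
def densities (μX : Measure 𝒳) (μY : Measure 𝒴) : Set (𝒳 × 𝒴 → ℝ) :=
  {f | MemLp f 2 (μX.prod μY) ∧ 0 ≤ᵐ[μX.prod μY] f ∧ ∫ z, f z ∂(μX.prod μY) = 1}

/-- The measure of dependence `D(f) = ∫ (f(x, y) - f_X(x) f_Y(y))² dμ(x, y)`. -/
def dependence (μX : Measure 𝒳) (μY : Measure 𝒴) (f : 𝒳 × 𝒴 → ℝ) : ℝ :=
  ∫ z, (f z - marginalX μY f z.1 * marginalY μX f z.2) ^ 2 ∂(μX.prod μY)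

/-- The supremum norm `sup_z |g z|`, with values in `[0, ∞]`. -/
def supNorm {Z : Type*} (g : Z → ℝ) : ℝ≥0∞ := ⨆ z, ENNReal.ofReal |g z|

section Bases

variable {J K : Type*} {μX : Measure 𝒳} {μY : Measure 𝒴}

/-- `a_{jk}(f) = ∫ f p_{jk} dμ`, where `p_{jk}(x, y) = p_j^X(x) p_k^Y(y)`. -/
def coeff (bX : HilbertBasis J ℝ (Lp ℝ 2 μX)) (bY : HilbertBasis K ℝ (Lp ℝ 2 μY))
    (f : 𝒳 × 𝒴 → ℝ) (j : J) (k : K) : ℝ :=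
  ∫ z, f z * (bX j z.1 * bY k z.2) ∂(μX.prod μY)

/-- `a_{j•}(f) = ∫ f_X p_j^X dμ_X`. -/
def coeffX (bX : HilbertBasis J ℝ (Lp ℝ 2 μX)) (μY : Measure 𝒴)
    (f : 𝒳 × 𝒴 → ℝ) (j : J) : ℝ :=
  ∫ x, marginalX μY f x * bX j x ∂μX

/-- `a_{•k}(f) = ∫ f_Y p_k^Y dμ_Y`. -/
def coeffY (μX : Measure 𝒳) (bY : HilbertBasis K ℝ (Lp ℝ 2 μY))
    (f : 𝒳 × 𝒴 → ℝ) (k : K) : ℝ :=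
  ∫ y, marginalY μX f y * bY k y ∂μY

/-- `S_θ(f) = ∑_{j,k} θ_{jk}² (a_{jk}(f) - a_{j•}(f) a_{•k}(f))²`, a sum in `[0, ∞]` with the
convention `∞ · 0 = 0`. -/
def smoothness (bX : HilbertBasis J ℝ (Lp ℝ 2 μX)) (bY : HilbertBasis K ℝ (Lp ℝ 2 μY))
    (θ : J → K → ℝ≥0∞) (f : 𝒳 × 𝒴 → ℝ) : ℝ≥0∞ :=
  ∑' j, ∑' k, θ j k ^ 2 *
    ENNReal.ofReal ((coeff bX bY f j k - coeffX bX μY f j * coeffY μX bY f k) ^ 2)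

/-- The class of alternatives `𝓕_ξ(ρ)` for `ξ = (θ, r, A)`. The bounds on the marginals force them
to be square integrable, so that `D(f)` is a convergent integral. -/
def alternatives (bX : HilbertBasis J ℝ (Lp ℝ 2 μX)) (bY : HilbertBasis K ℝ (Lp ℝ 2 μY))
    (θ : J → K → ℝ≥0∞) (r A ρ : ℝ) : Set (𝒳 × 𝒴 → ℝ) :=
  {f | f ∈ densities μX μY ∧ ρ ^ 2 ≤ dependence μX μY f ∧
    smoothness bX bY θ f ≤ ENNReal.ofReal (r ^ 2) ∧
    max (supNorm f) (max (supNorm (marginalX μY f)) (supNorm (marginalY μX f)))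
      ≤ ENNReal.ofReal A}

end Bases

/-- Expectation of `ψ` evaluated at `n` i.i.d. pairs with distribution `P`. -/
def expect {n : ℕ} (P : Measure (𝒳 × 𝒴)) (ψ : (Fin n → 𝒳 × 𝒴) → ℝ) : ℝ :=
  ∫ w, ψ w ∂(Measure.pi fun _ : Fin n => P)

/-- The distribution on `𝒳 × 𝒴` with density `f` with respect to `μ_X ⊗ μ_Y`. -/
def law (μX : Measure 𝒳) (μY : Measure 𝒴) (f : 𝒳 × 𝒴 → ℝ) : Measure (𝒳 × 𝒴) :=
  (μX.prod μY).withDensity fun z => ENNReal.ofReal (f z)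

/-- The set `Ψ` of randomised tests based on `n` observations. -/
def tests (𝒳 : Type u) (𝒴 : Type v) [MeasurableSpace 𝒳] [MeasurableSpace 𝒴] (n : ℕ) :
    Set ((Fin n → 𝒳 × 𝒴) → ℝ) :=
  {ψ | Measurable ψ ∧ ∀ w, ψ w ∈ Set.Icc (0 : ℝ) 1}

/-- The null space `𝒫₀`: the distributions of pairs `(X, Y)` with `X` and `Y` independent. -/
def nullSpace (𝒳 : Type u) (𝒴 : Type v) [MeasurableSpace 𝒳] [MeasurableSpace 𝒴] :
    Set (Measure (𝒳 × 𝒴)) :=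
  {P | IsProbabilityMeasure P ∧ IndepFun Prod.fst Prod.snd P}

/-- The set `Ψ(α)` of independence tests of size at most `α`. -/
def validTests (𝒳 : Type u) (𝒴 : Type v) [MeasurableSpace 𝒳] [MeasurableSpace 𝒴]
    (n : ℕ) (α : ℝ) : Set ((Fin n → 𝒳 × 𝒴) → ℝ) :=
  {ψ | ψ ∈ tests 𝒳 𝒴 n ∧ ∀ P ∈ nullSpace 𝒳 𝒴, expect P ψ ≤ α}

section Risk

variable {J K : Type*} {μX : Measure 𝒳} {μY : Measure 𝒴}

/-- The minimax risk `α + inf_{ψ ∈ Ψ(α)} sup_{f ∈ 𝓕_ξ(ρ)} E_f(1 - ψ)`. All expectations lie in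
`[0, 1]`; over an empty class of alternatives the supremum is `0`, so the risk is then `α`. -/
def testingRisk (bX : HilbertBasis J ℝ (Lp ℝ 2 μX)) (bY : HilbertBasis K ℝ (Lp ℝ 2 μY))
    (n : ℕ) (α : ℝ) (θ : J → K → ℝ≥0∞) (r A ρ : ℝ) : ℝ :=
  α + ⨅ ψ : validTests 𝒳 𝒴 n α, ⨆ f : alternatives bX bY θ r A ρ,
    expect (law μX μY f.1) (fun w => 1 - ψ.1 w)

/-- The minimax separation radius `ρ*(n, α, β, ξ) = inf {ρ > 0 : risk at ρ is at most α + β}`,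
an infimum in `[0, ∞]` (so that it is `∞` if there is no such `ρ`). -/
def separationRadius (bX : HilbertBasis J ℝ (Lp ℝ 2 μX)) (bY : HilbertBasis K ℝ (Lp ℝ 2 μY))
    (n : ℕ) (α β : ℝ) (θ : J → K → ℝ≥0∞) (r A : ℝ) : ℝ≥0∞ :=
  sInf {x | ∃ ρ : ℝ, 0 < ρ ∧ testingRisk bX bY n α θ r A ρ ≤ α + β ∧ x = ENNReal.ofReal ρ}

end Risk

/-- The norm `‖j‖₁` of a multi-index. -/
def multiNorm {d : ℕ} (j : Fin d → ℕ) : ℝ := ∑ i, (j i : ℝ)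

open Classical in
/-- The weights `θ_{jk} = ‖j‖₁^{s_X} ∨ ‖k‖₁^{s_Y}` if `j ≠ 0` and `k ≠ 0`, and `θ_{jk} = ∞`
otherwise. -/
def sobolevWeight (dX dY : ℕ) (sX sY : ℝ) (j : Fin dX → ℕ) (k : Fin dY → ℕ) : ℝ≥0∞ :=
  if j ≠ 0 ∧ k ≠ 0 then ENNReal.ofReal (max (multiNorm j ^ sX) (multiNorm k ^ sY)) else ⊤

/-- The overall smoothness `s = d / (d_X / s_X + d_Y / s_Y)`, where `d = d_X + d_Y`. -/
def overallSmoothness (dX dY : ℕ) (sX sY : ℝ) : ℝ :=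
  ((dX : ℝ) + dY) / (dX / sX + dY / sY)

end

end IndepTesting

/-! The bound is witnessed by one test, calibrated without knowledge of the null distribution. Split
`4m` observations, `m = n / 4`, into two blocks of `m` pairs. Under independence, exchanging the
second components within a pair preserves the law of the pair, and the contrast vector `W` changes
sign under this exchange. Let `S` be the sum of `W` over the second block, `T` the sum of the
projections of `W` on `S` over the first, and `Q` the sum of their squares. Given the second block,
random flips in the first block change only the signs of the summands of `T`, and the mean of `T ^
2` over all sign patterns is `Q`. By Markov, rejecting when `Q < α * T ^ 2` has size at most `α` for
every null law (`measure_rejectionRegion_le`).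

Under an alternative, `W` has mean `δ`, the vector of interaction coefficients over a finite index
set `F` (`integral_contrast_prodBasis`). Boundedness by `A` makes both the law and the product of
its marginals dominated by a multiple of `μ`, so orthonormality bounds the second moment operator of
`W` by `B = 2A + 2A²`, whatever the size of `F` (`integral_contrast_dotProduct_sq_le`). Chebyshev
applied to `T`, whose mean is `m² |δ|²`, bounds the type II error by a multiple of `B / (m |δ|²) +
|F| B² / (m |δ|²)²` (`measure_compl_rejectionRegion_le`).

Finally, by Parseval `D(f)` is the sum of all squared interaction coefficients, and smoothness
bounds the part outside `F` by `r² / T²` when the weights there are at least a cut-off `T`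
(`dependence_le_truncation_add`). With `T = r / R`, `R` the claimed rate, this bias is `R²` and
`|F|` is at most a multiple of `(n R²)²` (`rate_balance`), so a signal of order `R²` is detected
once its constant is large. -/

namespace IndepTesting

/-! ### Size of the sign-flip test. -/

section SignFlip

variable {Ω ι : Type*} [Fintype ι] {m : ℕ}

/-- The coordinatewise sum of `W` over a block of observations. -/
def blockSum (W : Ω → ι → ℝ) (v : Fin m → Ω) : ι → ℝ := fun a => ∑ i, W (v i) a

/-- The sum over a block of observations of the projections of `W` on the vector `s`. -/
def projSum (W : Ω → ι → ℝ) (s : ι → ℝ) (u : Fin m → Ω) : ℝ := ∑ i, W (u i) ⬝ᵥ s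

/-- The sum over a block of observations of the squared projections of `W` on the vector `s`. -/
def projSqSum (W : Ω → ι → ℝ) (s : ι → ℝ) (u : Fin m → Ω) : ℝ := ∑ i, (W (u i) ⬝ᵥ s) ^ 2

/-- The rejection region of the sign-flip test. -/
def rejectionRegion (W : Ω → ι → ℝ) (α : ℝ) (m : ℕ) : Set ((Fin m → Ω) × (Fin m → Ω)) :=
  {p | projSqSum W (blockSum W p.2) p.1 < α * projSum W (blockSum W p.2) p.1 ^ 2}

/-- The sign attached to a Boolean. -/
def boolSign (b : Bool) : ℝ := if b then -1 else 1

lemma boolSign_sq (b : Bool) : boolSign b * boolSign b = 1 := by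
  cases b <;> simp [boolSign]

lemma boolSign_not (b : Bool) : boolSign (!b) = - boolSign b := by
  cases b <;> simp [boolSign]

/-- Orthogonality of independent random signs: for distinct indices, flipping the `i`-th sign is an
involution of the sign patterns that negates the summand. -/
lemma sum_boolSign_mul (i j : Fin m) :
    ∑ ε : Fin m → Bool, boolSign (ε i) * boolSign (ε j) = if i = j then 2 ^ m else 0 := by
  split_ifs with h
  · subst h
    simp [boolSign_sq]
  · have hinv : Function.Involutive (fun ε : Fin m → Bool => Function.update ε i (!(ε i))) := by
      intro ε
      simp
    have := Equiv.sum_comp hinv.toPerm (fun ε : Fin m → Bool => boolSign (ε i) * boolSign (ε j))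
    simp only [Function.Involutive.coe_toPerm, Function.update_self, boolSign_not,
      Function.update_of_ne (Ne.symm h), neg_mul, Finset.sum_neg_distrib] at this
    linarith

lemma sum_sq_boolSign (c : Fin m → ℝ) :
    ∑ ε : Fin m → Bool, (∑ i, boolSign (ε i) * c i) ^ 2 = 2 ^ m * ∑ i, c i ^ 2 := by
  have h : ∀ ε : Fin m → Bool, (∑ i, boolSign (ε i) * c i) ^ 2
      = ∑ i, ∑ j, (boolSign (ε i) * boolSign (ε j)) * (c i * c j) := by
    intro ε
    rw [sq, Finset.sum_mul_sum]
    exact Finset.sum_congr rfl fun i _ => Finset.sum_congr rfl fun j _ => by ring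
  simp_rw [h]
  rw [Finset.sum_comm, Finset.mul_sum]
  refine Finset.sum_congr rfl fun i _ => ?_
  rw [Finset.sum_comm]
  simp_rw [← Finset.sum_mul, sum_boolSign_mul]
  simp [sq]

/-- Markov's inequality for the uniform distribution on sign patterns, under which the squared
signed sum has mean `∑ i, c i ^ 2`. -/
lemma card_sign_exceed {α : ℝ} (hα : 0 < α) (c : Fin m → ℝ) :
    (((Finset.univ : Finset (Fin m → Bool)).filter
      fun ε => ∑ i, c i ^ 2 < α * (∑ i, boolSign (ε i) * c i) ^ 2).card : ℝ) ≤ α * 2 ^ m := by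
  classical
  set Q := ∑ i, c i ^ 2 with hQ
  set F := (Finset.univ : Finset (Fin m → Bool)).filter
      fun ε => Q < α * (∑ i, boolSign (ε i) * c i) ^ 2
  have hQ0 : 0 ≤ Q := Finset.sum_nonneg fun i _ => sq_nonneg _
  -- Markov divides by `Q`. If `Q = 0` every `c i` vanishes, and the strict inequality in the
  -- rejection rule then excludes all patterns.
  rcases hQ0.eq_or_lt with h | h
  · have hc : ∀ i, c i = 0 := by
      intro i
      have := (Finset.sum_eq_zero_iff_of_nonneg (fun i _ => sq_nonneg (c i))).1 h.symm i
        (Finset.mem_univ i)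
      exact pow_eq_zero_iff two_ne_zero |>.1 this
    have : F = ∅ := by
      apply Finset.filter_eq_empty_iff.2
      intro ε _
      simp [hc, hQ]
    rw [this]
    simp only [Finset.card_empty, Nat.cast_zero]
    positivity
  · have h1 : (F.card : ℝ) * Q ≤ ∑ ε ∈ F, α * (∑ i, boolSign (ε i) * c i) ^ 2 := by
      rw [← nsmul_eq_mul]
      exact Finset.card_nsmul_le_sum _ _ _ fun ε hε => (Finset.mem_filter.1 hε).2.le
    have h2 : ∑ ε ∈ F, α * (∑ i, boolSign (ε i) * c i) ^ 2
        ≤ ∑ ε : Fin m → Bool, α * (∑ i, boolSign (ε i) * c i) ^ 2 :=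
      Finset.sum_le_sum_of_subset_of_nonneg (Finset.subset_univ _) fun _ _ _ => by positivity
    rw [← Finset.mul_sum Finset.univ, sum_sq_boolSign, ← mul_assoc] at h2
    exact le_of_mul_le_mul_right (h1.trans h2) h

/-- Apply `τ` to the observations of the first block that `ε` selects. -/
def flipMap (τ : Ω → Ω) (ε : Fin m → Bool) (p : (Fin m → Ω) × (Fin m → Ω)) :
    (Fin m → Ω) × (Fin m → Ω) :=
  (fun i => if ε i then τ (p.1 i) else p.1 i, p.2)

/-- Flips leave the second block, hence the projection direction, and all squared projections
unchanged; only the signs in the linear sum move. -/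
lemma flipMap_mem_rejectionRegion {W : Ω → ι → ℝ} {τ : Ω → Ω} (hWτ : ∀ z, W (τ z) = - W z)
    {α : ℝ} (ε : Fin m → Bool) (p : (Fin m → Ω) × (Fin m → Ω)) :
    flipMap τ ε p ∈ rejectionRegion W α m ↔
      ∑ i, (W (p.1 i) ⬝ᵥ blockSum W p.2) ^ 2 <
        α * (∑ i, boolSign (ε i) * (W (p.1 i) ⬝ᵥ blockSum W p.2)) ^ 2 := by
  have h : ∀ i, W (if ε i then τ (p.1 i) else p.1 i) ⬝ᵥ blockSum W p.2
      = boolSign (ε i) * (W (p.1 i) ⬝ᵥ blockSum W p.2) := by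
    intro i
    cases ε i <;> simp [hWτ, boolSign]
  have h2 : ∀ i, (boolSign (ε i) * (W (p.1 i) ⬝ᵥ blockSum W p.2)) ^ 2
      = (W (p.1 i) ⬝ᵥ blockSum W p.2) ^ 2 := by
    intro i
    rw [mul_pow, sq (boolSign _), boolSign_sq, one_mul]
  simp only [rejectionRegion, flipMap, projSqSum, projSum, Set.mem_ofPred_eq, h, h2]

variable [MeasurableSpace Ω]

omit [Fintype ι] in
lemma measurable_blockSum {W : Ω → ι → ℝ} (hW : Measurable W) :
    Measurable (blockSum W : (Fin m → Ω) → ι → ℝ) := by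
  unfold blockSum
  fun_prop

lemma measurable_dotProduct_comp {β : Type*} [MeasurableSpace β] {f g : β → ι → ℝ}
    (hf : Measurable f) (hg : Measurable g) : Measurable fun x => f x ⬝ᵥ g x := by
  unfold dotProduct
  fun_prop

lemma measurable_projSum {W : Ω → ι → ℝ} (hW : Measurable W) :
    Measurable fun p : (Fin m → Ω) × (Fin m → Ω) => projSum W (blockSum W p.2) p.1 := by
  unfold projSum
  refine Finset.measurable_sum _ fun i _ => measurable_dotProduct_comp ?_ ?_
  · exact hW.comp ((measurable_pi_apply i).comp measurable_fst)
  · exact (measurable_blockSum hW).comp measurable_snd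

lemma measurable_projSqSum {W : Ω → ι → ℝ} (hW : Measurable W) :
    Measurable fun p : (Fin m → Ω) × (Fin m → Ω) => projSqSum W (blockSum W p.2) p.1 := by
  unfold projSqSum
  refine Finset.measurable_sum _ fun i _ => (measurable_dotProduct_comp ?_ ?_).pow_const 2
  · exact hW.comp ((measurable_pi_apply i).comp measurable_fst)
  · exact (measurable_blockSum hW).comp measurable_snd

lemma measurableSet_rejectionRegion {W : Ω → ι → ℝ} (hW : Measurable W) (α : ℝ) :
    MeasurableSet (rejectionRegion W α m) :=
  measurableSet_lt (measurable_projSqSum hW) (((measurable_projSum hW).pow_const 2).const_mul α)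

lemma measurePreserving_flipMap {ν : Measure Ω} [IsProbabilityMeasure ν] {τ : Ω → Ω}
    (hτ : MeasurePreserving τ ν ν) (ε : Fin m → Bool) :
    MeasurePreserving (flipMap τ ε)
      ((Measure.pi fun _ : Fin m => ν).prod (Measure.pi fun _ : Fin m => ν))
      ((Measure.pi fun _ : Fin m => ν).prod (Measure.pi fun _ : Fin m => ν)) := by
  have h1 : MeasurePreserving (fun (u : Fin m → Ω) i => if ε i then τ (u i) else u i)
      (Measure.pi fun _ : Fin m => ν) (Measure.pi fun _ : Fin m => ν) := by
    refine measurePreserving_pi (f := fun i x => if ε i then τ x else x) _ _ fun i => ?_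
    cases ε i
    · exact MeasurePreserving.id ν
    · exact hτ
  exact h1.prod (MeasurePreserving.id _)

/-- The sign-flip test has size at most `α` if the law of the observations is preserved by a map
that changes the sign of `W`. -/
theorem measure_rejectionRegion_le {ν : Measure Ω} [IsProbabilityMeasure ν] {τ : Ω → Ω}
    (hτ : MeasurePreserving τ ν ν) {W : Ω → ι → ℝ} (hW : Measurable W)
    (hWτ : ∀ z, W (τ z) = - W z) {α : ℝ} (hα : 0 < α) :
    ((Measure.pi fun _ : Fin m => ν).prod (Measure.pi fun _ : Fin m => ν))
      (rejectionRegion W α m) ≤ ENNReal.ofReal α := by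
  classical
  set μ := (Measure.pi fun _ : Fin m => ν).prod (Measure.pi fun _ : Fin m => ν) with hμ
  set R := rejectionRegion W α m
  have hR : MeasurableSet R := measurableSet_rejectionRegion hW α
  have hmeas : ∀ ε : Fin m → Bool, MeasurableSet (flipMap τ ε ⁻¹' R) := fun ε =>
    (measurePreserving_flipMap hτ ε).measurable hR
  -- Every flip pattern preserves `μ`, so the rejection probability may be averaged over patterns;
  -- exchanging sum and integral leaves a count of patterns at a fixed sample.
  have h1 : ∑ ε : Fin m → Bool, μ (flipMap τ ε ⁻¹' R) = 2 ^ m * μ R := by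
    rw [Finset.sum_congr rfl fun ε _ =>
      (measurePreserving_flipMap hτ ε).measure_preimage hR.nullMeasurableSet]
    simp [hμ]
  have h2 : ∑ ε : Fin m → Bool, μ (flipMap τ ε ⁻¹' R) ≤ ENNReal.ofReal (α * 2 ^ m) := by
    calc ∑ ε : Fin m → Bool, μ (flipMap τ ε ⁻¹' R)
        = ∫⁻ p, ∑ ε : Fin m → Bool, (flipMap τ ε ⁻¹' R).indicator 1 p ∂μ := by
          rw [lintegral_finsetSum _ fun ε _ => measurable_one.indicator (hmeas ε)]
          exact Finset.sum_congr rfl fun ε _ => (lintegral_indicator_one (hmeas ε)).symm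
      _ ≤ ∫⁻ _, ENNReal.ofReal (α * 2 ^ m) ∂μ := by
          refine lintegral_mono fun p => ?_
          have := card_sign_exceed hα fun i => W (p.1 i) ⬝ᵥ blockSum W p.2
          simp only [Set.indicator_apply, Set.mem_preimage, R,
            flipMap_mem_rejectionRegion hWτ, Pi.one_apply, Finset.sum_boole]
          rw [← ENNReal.ofReal_natCast]
          exact ENNReal.ofReal_le_ofReal this
      _ = ENNReal.ofReal (α * 2 ^ m) := by simp [hμ]
  rw [h1, ENNReal.ofReal_mul hα.le, mul_comm, ENNReal.ofReal_pow (by norm_num)] at h2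
  simp only [ENNReal.ofReal_ofNat] at h2
  exact (ENNReal.mul_le_mul_iff_left (by simp) (by finiteness)).1 h2

end SignFlip

/-! ### Type II error by Chebyshev's inequality. -/

section Moments

variable {Ω ι : Type*} [Fintype ι] [MeasurableSpace Ω] {m : ℕ} {ν : Measure Ω}
  [IsProbabilityMeasure ν]

lemma lintegral_sum_sub_sq_le {g : Ω → ℝ} (hg : MemLp g 2 ν) :
    ∫⁻ u, ENNReal.ofReal ((∑ i, g (u i) - m * ∫ z, g z ∂ν) ^ 2) ∂(Measure.pi fun _ : Fin m => ν)
      ≤ ENNReal.ofReal (m * ∫ z, g z ^ 2 ∂ν) := by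
  set X : (Fin m → Ω) → ℝ := ∑ i : Fin m, fun u => g (u i)
  have hX : MemLp X 2 (Measure.pi fun _ : Fin m => ν) :=
    memLp_finsetSum' _ fun i _ => hg.comp_measurePreserving (measurePreserving_eval _ i)
  have hmean : ∫ u, X u ∂(Measure.pi fun _ : Fin m => ν) = m * ∫ z, g z ∂ν := by
    simp only [X, Finset.sum_apply]
    rw [integral_finsetSum]
    · simp [integral_comp_eval (μ := fun _ : Fin m => ν) hg.aestronglyMeasurable]
    · intro i _
      exact (hg.comp_measurePreserving (measurePreserving_eval _ i)).integrable (by norm_num)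
  have hvar := variance_sum_pi (μ := fun _ : Fin m => ν) (X := fun _ => g) fun _ => hg
  have hle : Var[X; Measure.pi fun _ : Fin m => ν] ≤ m * ∫ z, g z ^ 2 ∂ν := by
    rw [hvar]
    simp only [Finset.sum_const, Finset.card_univ, Fintype.card_fin, nsmul_eq_mul]
    gcongr
    simpa using variance_le_expectation_sq hg.aestronglyMeasurable
  refine le_trans (le_of_eq ?_) (ENNReal.ofReal_le_ofReal hle)
  rw [hX.ofReal_variance_eq, evariance_eq_lintegral_ofReal, hmean]
  simp [X]

lemma lintegral_sum_sq_le {g : Ω → ℝ} (hg : MemLp g 2 ν) :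
    ∫⁻ u, ENNReal.ofReal (∑ i, g (u i) ^ 2) ∂(Measure.pi fun _ : Fin m => ν)
      ≤ ENNReal.ofReal (m * ∫ z, g z ^ 2 ∂ν) := by
  have hi : ∀ i : Fin m, Integrable (fun u : Fin m → Ω => g (u i) ^ 2)
      (Measure.pi fun _ : Fin m => ν) := fun i =>
    (hg.comp_measurePreserving (measurePreserving_eval (fun _ : Fin m => ν) i)).integrable_sq
  rw [← ofReal_integral_eq_lintegral_ofReal (integrable_finsetSum _ fun i _ => hi i)
    (Filter.Eventually.of_forall fun u => Finset.sum_nonneg fun i _ => sq_nonneg _),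
    integral_finsetSum _ fun i _ => hi i]
  refine ENNReal.ofReal_le_ofReal (le_of_eq ?_)
  simp [integral_comp_eval (μ := fun _ : Fin m => ν) (f := fun z => g z ^ 2)
    hg.integrable_sq.aestronglyMeasurable]

variable {W : Ω → ι → ℝ}

omit [IsProbabilityMeasure ν] in
lemma memLp_dotProduct (hW2 : ∀ a, MemLp (fun z => W z a) 2 ν) (s : ι → ℝ) :
    MemLp (fun z => W z ⬝ᵥ s) 2 ν := by
  unfold dotProduct
  exact memLp_finsetSum _ fun a _ => (hW2 a).mul_const (s a)

lemma integral_dotProduct (hW2 : ∀ a, MemLp (fun z => W z a) 2 ν) (s : ι → ℝ) :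
    ∫ z, W z ⬝ᵥ s ∂ν = (fun a => ∫ z, W z a ∂ν) ⬝ᵥ s := by
  unfold dotProduct
  rw [integral_finsetSum _ fun a _ => ((hW2 a).mul_const (s a)).integrable (by norm_num)]
  simp_rw [integral_mul_const]

omit [MeasurableSpace Ω] in
lemma dotProduct_blockSum (δ : ι → ℝ) (v : Fin m → Ω) :
    δ ⬝ᵥ blockSum W v = ∑ i, W (v i) ⬝ᵥ δ := by
  unfold blockSum dotProduct
  simp_rw [Finset.mul_sum]
  rw [Finset.sum_comm]
  simp_rw [mul_comm]

/-- Coordinatewise, the square is at most twice the squared deviation from the mean plus twice the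
squared mean; each coordinate of `W` has second moment at most `B`, as the choice of a unit vector
in `hB` shows. -/
lemma lintegral_blockSum_dotProduct_self_le (hW : Measurable W)
    (hW2 : ∀ a, MemLp (fun z => W z a) 2 ν) {B : ℝ}
    (hB : ∀ s : ι → ℝ, ∫ z, (W z ⬝ᵥ s) ^ 2 ∂ν ≤ B * (s ⬝ᵥ s)) {δ : ι → ℝ}
    (hδ : ∀ a, ∫ z, W z a ∂ν = δ a) :
    ∫⁻ v, ENNReal.ofReal (blockSum W v ⬝ᵥ blockSum W v) ∂(Measure.pi fun _ : Fin m => ν)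
      ≤ ENNReal.ofReal (2 * m * Fintype.card ι * B + 2 * m ^ 2 * (δ ⬝ᵥ δ)) := by
  classical
  have hB1 : ∀ a, ∫ z, W z a ^ 2 ∂ν ≤ B := fun a => by
    simpa using hB (Pi.single a 1)
  have hpt : ∀ v : Fin m → Ω, ENNReal.ofReal (blockSum W v ⬝ᵥ blockSum W v)
      ≤ ∑ a, (2 * ENNReal.ofReal ((∑ i, W (v i) a - m * ∫ z, W z a ∂ν) ^ 2)
        + ENNReal.ofReal (2 * m ^ 2 * (δ a * δ a))) := by
    intro v
    unfold dotProduct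
    rw [ENNReal.ofReal_sum_of_nonneg fun a _ => mul_self_nonneg _]
    refine Finset.sum_le_sum fun a _ => ?_
    rw [← ENNReal.ofReal_ofNat 2, ← ENNReal.ofReal_mul (by norm_num),
      ← ENNReal.ofReal_add (by positivity) (by nlinarith [sq_nonneg (δ a), sq_nonneg (m : ℝ)])]
    refine ENNReal.ofReal_le_ofReal ?_
    rw [hδ, blockSum]
    nlinarith [sq_nonneg (∑ i, W (v i) a - 2 * (m * δ a))]
  have hmeas : ∀ a, Measurable fun v : Fin m → Ω =>
      2 * ENNReal.ofReal ((∑ i, W (v i) a - m * ∫ z, W z a ∂ν) ^ 2) := by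
    intro a
    have : Measurable fun z => W z a := (measurable_pi_apply a).comp hW
    fun_prop
  have hm0 : (0 : ℝ) ≤ m := m.cast_nonneg
  have hBn : ∀ a : ι, 0 ≤ B := fun a => (integral_nonneg fun z => sq_nonneg _).trans (hB1 a)
  calc ∫⁻ v, ENNReal.ofReal (blockSum W v ⬝ᵥ blockSum W v) ∂(Measure.pi fun _ : Fin m => ν)
      ≤ ∑ a, (2 * ENNReal.ofReal (m * B) + ENNReal.ofReal (2 * m ^ 2 * (δ a * δ a))) := by
        refine (lintegral_mono hpt).trans ?_
        rw [lintegral_finsetSum _ fun a _ => (hmeas a).add_const _]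
        refine Finset.sum_le_sum fun a _ => ?_
        rw [lintegral_add_right _ measurable_const, lintegral_const_mul' _ _ (by simp)]
        gcongr
        · refine (lintegral_sum_sub_sq_le (hW2 a)).trans ?_
          gcongr
          exact hB1 a
        · simp
    _ = ENNReal.ofReal (∑ a, (2 * (m * B) + 2 * m ^ 2 * (δ a * δ a))) := by
        rw [ENNReal.ofReal_sum_of_nonneg]
        · refine Finset.sum_congr rfl fun a _ => ?_
          rw [ENNReal.ofReal_add, ENNReal.ofReal_mul (p := 2) (by norm_num), ENNReal.ofReal_ofNat]
          · have := hBn a; positivity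
          · exact mul_nonneg (by positivity) (mul_self_nonneg _)
        · intro a _
          have := hBn a
          have := mul_self_nonneg (δ a)
          positivity
    _ = _ := by
        congr 1
        rw [Finset.sum_add_distrib, ← Finset.mul_sum _ fun a => δ a * δ a]
        simp only [Finset.sum_const, Finset.card_univ, nsmul_eq_mul, dotProduct]
        ring

/-- The type II error of the sign-flip test, in terms of the mean `δ` and a bound `B` on the second
moment operator of `W`. -/
theorem measure_compl_rejectionRegion_le (hW : Measurable W)
    (hW2 : ∀ a, MemLp (fun z => W z a) 2 ν) {B : ℝ} (hB0 : 0 ≤ B)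
    (hB : ∀ s : ι → ℝ, ∫ z, (W z ⬝ᵥ s) ^ 2 ∂ν ≤ B * (s ⬝ᵥ s)) {δ : ι → ℝ}
    (hδ : ∀ a, ∫ z, W z a ∂ν = δ a) (hδ0 : 0 < δ ⬝ᵥ δ) (hm : 0 < m) {α : ℝ} (hα : 0 < α) :
    ((Measure.pi fun _ : Fin m => ν).prod (Measure.pi fun _ : Fin m => ν))
      (rejectionRegion W α m)ᶜ ≤ ENNReal.ofReal ((12 + 4 / α) *
        (B / (m * (δ ⬝ᵥ δ)) + Fintype.card ι * B ^ 2 / (m * (δ ⬝ᵥ δ)) ^ 2)) := by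
  set π := Measure.pi fun _ : Fin m => ν with hπ
  set Δ := δ ⬝ᵥ δ with hΔ
  set N : ℝ := (Fintype.card ι : ℝ) with hN
  have hm' : (0 : ℝ) < m := by exact_mod_cast hm
  -- `L` is the mean of the statistic, and `K` below bounds the mean squared length of the second
  -- block sum.
  set L : ℝ := m ^ 2 * Δ with hL
  have hL0 : 0 < L := by positivity
  have hN0 : 0 ≤ N := by positivity
  set K : ℝ := 2 * m * N * B + 2 * m ^ 2 * Δ with hK
  have hK0 : 0 ≤ K := by positivity
  have hS := lintegral_blockSum_dotProduct_self_le (m := m) hW hW2 hB hδ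
  rw [← hπ, ← hN, ← hΔ, ← hK] at hS
  have hSm : Measurable (blockSum W : (Fin m → Ω) → ι → ℝ) := measurable_blockSum hW
  have hint : ∀ s : ι → ℝ, ∫ z, W z ⬝ᵥ s ∂ν = δ ⬝ᵥ s := fun s => by
    rw [integral_dotProduct hW2]; simp_rw [hδ]
  -- This is where the split into two blocks pays: with the second block `v` fixed, the direction
  -- `blockSum W v` is deterministic for the first block, so the bound `hB` applies to it before
  -- integrating over `v`.
  have hfub : ∀ F : (Fin m → Ω) × (Fin m → Ω) → ℝ≥0∞, Measurable F →
      (∀ v, ∫⁻ u, F (u, v) ∂π ≤ ENNReal.ofReal (m * (B * (blockSum W v ⬝ᵥ blockSum W v)))) →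
      ∫⁻ p, F p ∂(π.prod π) ≤ ENNReal.ofReal (m * B * K) := by
    intro F hF h
    rw [lintegral_prod_symm' _ hF]
    refine (lintegral_mono h).trans ?_
    rw [ENNReal.ofReal_mul (by positivity : 0 ≤ m * B)]
    have h' : ∀ v : Fin m → Ω, ENNReal.ofReal (m * (B * (blockSum W v ⬝ᵥ blockSum W v)))
        = ENNReal.ofReal (m * B) * ENNReal.ofReal (blockSum W v ⬝ᵥ blockSum W v) := fun v => by
      rw [← mul_assoc, ENNReal.ofReal_mul (by positivity)]
    rw [lintegral_congr h', lintegral_const_mul' _ _ ENNReal.ofReal_ne_top]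
    gcongr
  have hmδ : Measurable fun p : (Fin m → Ω) × (Fin m → Ω) => δ ⬝ᵥ blockSum W p.2 :=
    measurable_dotProduct_comp measurable_const (hSm.comp measurable_snd)
  have hT := measurable_projSum (m := m) hW
  have hQ := measurable_projSqSum (m := m) hW
  have h1 : ∫⁻ p, ENNReal.ofReal ((projSum W (blockSum W p.2) p.1
      - m * (δ ⬝ᵥ blockSum W p.2)) ^ 2) ∂(π.prod π) ≤ ENNReal.ofReal (m * B * K) := by
    refine hfub _ (by fun_prop) fun v => ?_
    have := lintegral_sum_sub_sq_le (m := m) (memLp_dotProduct hW2 (blockSum W v))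
    rw [hint] at this
    refine this.trans ?_
    gcongr
    exact hB _
  have h2 : ∫⁻ p, ENNReal.ofReal (projSqSum W (blockSum W p.2) p.1) ∂(π.prod π)
      ≤ ENNReal.ofReal (m * B * K) := by
    refine hfub _ (by fun_prop) fun v => ?_
    refine (lintegral_sum_sq_le (m := m) (memLp_dotProduct hW2 (blockSum W v))).trans ?_
    gcongr
    exact hB _
  have h3 : ∫⁻ p, ENNReal.ofReal ((δ ⬝ᵥ blockSum W p.2 - m * Δ) ^ 2) ∂(π.prod π)
      ≤ ENNReal.ofReal (m * (B * Δ)) := by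
    rw [lintegral_prod_symm' _ (by fun_prop)]
    simp only [lintegral_const, hπ, measure_univ, mul_one]
    have := lintegral_sum_sub_sq_le (m := m) (memLp_dotProduct hW2 δ)
    rw [hint] at this
    simp_rw [dotProduct_blockSum]
    refine this.trans ?_
    gcongr
    exact hB _
  have hpt : ∀ p, (rejectionRegion W α m)ᶜ.indicator (1 : (Fin m → Ω) × (Fin m → Ω) → ℝ≥0∞) p ≤
      ENNReal.ofReal (4 / L ^ 2) * ENNReal.ofReal ((projSum W (blockSum W p.2) p.1
        - m * (δ ⬝ᵥ blockSum W p.2)) ^ 2)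
      + ENNReal.ofReal (4 * m ^ 2 / L ^ 2) * ENNReal.ofReal ((δ ⬝ᵥ blockSum W p.2 - m * Δ) ^ 2)
      + ENNReal.ofReal (2 / (α * L ^ 2)) * ENNReal.ofReal (projSqSum W (blockSum W p.2) p.1) := by
    intro p
    refine Set.indicator_apply_le' (fun hp => ?_) fun _ => zero_le
    have hQ0 : 0 ≤ projSqSum W (blockSum W p.2) p.1 := Finset.sum_nonneg fun _ _ => sq_nonneg _
    have hp' : α * projSum W (blockSum W p.2) p.1 ^ 2 ≤ projSqSum W (blockSum W p.2) p.1 := by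
      simpa [rejectionRegion] using hp
    rw [← ENNReal.ofReal_mul (by positivity), ← ENNReal.ofReal_mul (by positivity),
      ← ENNReal.ofReal_mul (by positivity), ← ENNReal.ofReal_add (by positivity) (by positivity),
      ← ENNReal.ofReal_add (by positivity) (by positivity), Pi.one_apply, ENNReal.one_le_ofReal]
    set T := projSum W (blockSum W p.2) p.1
    set Q := projSqSum W (blockSum W p.2) p.1
    set x := δ ⬝ᵥ blockSum W p.2
    have hTQ : T ^ 2 ≤ Q / α := by rw [le_div_iff₀ hα]; linarith
    -- If the test accepts, `T ^ 2` is at most `Q / α`, so `L` must be accounted for by `T`, by the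
    -- fluctuation of `T` given the second block, or by that of the second block itself; `(a + b)² ≤
    -- 2a² + 2b²` is used twice.
    have key : L ^ 2 ≤ 4 * (T - m * x) ^ 2 + 4 * m ^ 2 * (x - m * Δ) ^ 2 + 2 * (Q / α) := by
      have : L = T - (T - m * x) - (m * x - L) := by ring
      have h5 : m ^ 2 * (x - m * Δ) ^ 2 = (m * x - L) ^ 2 := by rw [hL]; ring
      rw [mul_assoc 4, h5]
      nlinarith [sq_nonneg (T + ((T - m * x) + (m * x - L))),
        sq_nonneg ((T - m * x) - (m * x - L))]
    calc (1 : ℝ) = L ^ 2 / L ^ 2 := (div_self (by positivity)).symm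
      _ ≤ (4 * (T - m * x) ^ 2 + 4 * m ^ 2 * (x - m * Δ) ^ 2 + 2 * (Q / α)) / L ^ 2 := by gcongr
      _ = _ := by field_simp
  have hR := measurableSet_rejectionRegion (m := m) hW α
  calc (π.prod π) (rejectionRegion W α m)ᶜ
      = ∫⁻ p, (rejectionRegion W α m)ᶜ.indicator 1 p ∂(π.prod π) :=
        (lintegral_indicator_one hR.compl).symm
    _ ≤ ENNReal.ofReal (4 / L ^ 2) * ENNReal.ofReal (m * B * K)
        + ENNReal.ofReal (4 * m ^ 2 / L ^ 2) * ENNReal.ofReal (m * (B * Δ))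
        + ENNReal.ofReal (2 / (α * L ^ 2)) * ENNReal.ofReal (m * B * K) := by
        refine (lintegral_mono hpt).trans ?_
        rw [lintegral_add_right _ (by fun_prop), lintegral_add_right _ (by fun_prop),
          lintegral_const_mul' _ _ (by simp), lintegral_const_mul' _ _ (by simp),
          lintegral_const_mul' _ _ (by simp)]
        gcongr
    _ ≤ _ := by
        rw [← ENNReal.ofReal_mul (by positivity), ← ENNReal.ofReal_mul (by positivity),
          ← ENNReal.ofReal_mul (by positivity), ← ENNReal.ofReal_add (by positivity) (by positivity),
          ← ENNReal.ofReal_add (by positivity) (by positivity)]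
        refine ENNReal.ofReal_le_ofReal ?_
        have e : 4 / L ^ 2 * (m * B * K) + 4 * m ^ 2 / L ^ 2 * (m * (B * Δ))
            + 2 / (α * L ^ 2) * (m * B * K)
            = (12 + 4 / α) * (B / (m * Δ)) + (8 + 4 / α) * (N * B ^ 2 / (m * Δ) ^ 2) := by
          rw [hK, hL]
          field_simp
          ring
        rw [e, mul_add]
        gcongr
        norm_num

end Moments

/-! ### Arranging the sample into independent pairs. -/

section Blocks

variable {Z : Type*} [MeasurableSpace Z] {m n : ℕ}

/-- Arrange `4m` of the `n` observations into two blocks of `m` pairs. -/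
def blockMap (e : (Fin m ⊕ Fin m) ⊕ (Fin m ⊕ Fin m) ↪ Fin n) (w : Fin n → Z) :
    (Fin m → Z × Z) × (Fin m → Z × Z) :=
  (fun i => (w (e (.inl (.inl i))), w (e (.inl (.inr i)))),
    fun i => (w (e (.inr (.inl i))), w (e (.inr (.inr i)))))

/-- Discards the observations left over when the sample size is not a multiple of four. -/
lemma measurePreserving_comp_embedding {ι κ : Type*} [Fintype ι] [Fintype κ] (e : ι ↪ κ)
    (P : Measure Z) [IsProbabilityMeasure P] :
    MeasurePreserving (fun (w : κ → Z) i => w (e i)) (Measure.pi fun _ : κ => P)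
      (Measure.pi fun _ : ι => P) where
  measurable := by fun_prop
  map_eq := by
    have h : iIndepFun (fun (k : κ) (w : κ → Z) => w k) (Measure.pi fun _ : κ => P) :=
      iIndepFun_pi (X := fun _ z => z) fun _ => aemeasurable_id
    have h2 := (h.precomp e.injective).map_fun_eq_pi_map
      fun i => (measurable_pi_apply (e i)).aemeasurable
    refine h2.trans ?_
    congr 1
    ext1 i
    exact (measurePreserving_eval (fun _ : κ => P) (e i)).map_eq

lemma measurePreserving_sumArrow_pairs (P : Measure Z) [IsProbabilityMeasure P] :
    MeasurePreserving (fun (w : Fin m ⊕ Fin m → Z) i => (w (.inl i), w (.inr i)))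
      (Measure.pi fun _ => P) (Measure.pi fun _ : Fin m => P.prod P) :=
  (measurePreserving_arrowProdEquivProdArrow Z Z (Fin m) (fun _ => P) fun _ => P).symm.comp
    (measurePreserving_sumPiEquivProdPi (X := fun _ : Fin m ⊕ Fin m => Z) fun _ => P)

lemma measurePreserving_blockMap (e : (Fin m ⊕ Fin m) ⊕ (Fin m ⊕ Fin m) ↪ Fin n)
    (P : Measure Z) [IsProbabilityMeasure P] :
    MeasurePreserving (blockMap e) (Measure.pi fun _ : Fin n => P)
      ((Measure.pi fun _ : Fin m => P.prod P).prod (Measure.pi fun _ : Fin m => P.prod P)) :=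
  ((measurePreserving_sumArrow_pairs P).prod (measurePreserving_sumArrow_pairs P)).comp
    ((measurePreserving_sumPiEquivProdPi
      (X := fun _ : (Fin m ⊕ Fin m) ⊕ (Fin m ⊕ Fin m) => Z) fun _ => P).comp
      (measurePreserving_comp_embedding e P))

lemma exists_blockEmbedding (h : 4 * m ≤ n) :
    Nonempty ((Fin m ⊕ Fin m) ⊕ (Fin m ⊕ Fin m) ↪ Fin n) := by
  refine Function.Embedding.nonempty_of_card_le ?_
  simp only [Fintype.card_sum, Fintype.card_fin]
  omega

end Blocks

/-! ### Invariance under the null and validity of the test. -/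

section Swap

variable {𝒳 : Type u} {𝒴 : Type v} [MeasurableSpace 𝒳] [MeasurableSpace 𝒴]

/-- Exchange the second components of two observations. -/
def swapSnd (q : (𝒳 × 𝒴) × (𝒳 × 𝒴)) : (𝒳 × 𝒴) × (𝒳 × 𝒴) :=
  ((q.1.1, q.2.2), (q.2.1, q.1.2))

lemma measurePreserving_swapSnd (μ : Measure 𝒳) (ν : Measure 𝒴) [SFinite μ] [SFinite ν] :
    MeasurePreserving (swapSnd (𝒳 := 𝒳) (𝒴 := 𝒴)) ((μ.prod ν).prod (μ.prod ν))
      ((μ.prod ν).prod (μ.prod ν)) := by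
  have h1 : MeasurePreserving (fun q : 𝒴 × 𝒳 × 𝒴 => (q.2.2, q.2.1, q.1))
      (ν.prod (μ.prod ν)) (ν.prod (μ.prod ν)) :=
    (measurePreserving_prodAssoc ν μ ν).comp
      (((Measure.measurePreserving_swap (μ := μ) (ν := ν)).prod (MeasurePreserving.id ν)).comp
        (Measure.measurePreserving_swap (μ := ν) (ν := μ.prod ν)))
  exact (measurePreserving_prodAssoc μ ν (μ.prod ν)).symm.comp
    (((MeasurePreserving.id μ).prod h1).comp (measurePreserving_prodAssoc μ ν (μ.prod ν)))

/-- Independence makes `P` the product of its marginals, and the exchange merely permutes the four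
factors of `P.prod P`. -/
lemma measurePreserving_swapSnd_of_mem_nullSpace {P : Measure (𝒳 × 𝒴)} (hP : P ∈ nullSpace 𝒳 𝒴) :
    MeasurePreserving (swapSnd (𝒳 := 𝒳) (𝒴 := 𝒴)) (P.prod P) (P.prod P) := by
  obtain ⟨_, hind⟩ := hP
  have h := (indepFun_iff_map_prod_eq_prod_map_map measurable_fst.aemeasurable
    measurable_snd.aemeasurable).1 hind
  have h' : P = (P.map Prod.fst).prod (P.map Prod.snd) := by
    rw [← h]
    exact Measure.map_id.symm
  rw [h']
  exact measurePreserving_swapSnd _ _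

variable {ι : Type*} [Fintype ι] {m n : ℕ}

/-- The sign-flip test based on `n` observations, as a `{0, 1}`-valued function. -/
noncomputable def signFlipTest (W : (𝒳 × 𝒴) × (𝒳 × 𝒴) → ι → ℝ) (α : ℝ)
    (e : (Fin m ⊕ Fin m) ⊕ (Fin m ⊕ Fin m) ↪ Fin n) : (Fin n → 𝒳 × 𝒴) → ℝ :=
  (blockMap e ⁻¹' rejectionRegion W α m).indicator 1

lemma measurable_blockMap (e : (Fin m ⊕ Fin m) ⊕ (Fin m ⊕ Fin m) ↪ Fin n) :
    Measurable (blockMap e : (Fin n → 𝒳 × 𝒴) → _) := by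
  unfold blockMap
  fun_prop

lemma measurableSet_preimage_rejectionRegion {W : (𝒳 × 𝒴) × (𝒳 × 𝒴) → ι → ℝ} (hW : Measurable W)
    (α : ℝ) (e : (Fin m ⊕ Fin m) ⊕ (Fin m ⊕ Fin m) ↪ Fin n) :
    MeasurableSet (blockMap e ⁻¹' rejectionRegion W α m) :=
  measurable_blockMap e (measurableSet_rejectionRegion hW α)

lemma signFlipTest_mem_validTests {W : (𝒳 × 𝒴) × (𝒳 × 𝒴) → ι → ℝ} (hW : Measurable W)
    (hWs : ∀ q, W (swapSnd q) = - W q) {α : ℝ} (hα : 0 < α)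
    (e : (Fin m ⊕ Fin m) ⊕ (Fin m ⊕ Fin m) ↪ Fin n) :
    signFlipTest W α e ∈ validTests 𝒳 𝒴 n α := by
  have hR := measurableSet_preimage_rejectionRegion hW α e
  refine ⟨⟨measurable_one.indicator hR, fun w => ?_⟩, fun P hP => ?_⟩
  · unfold signFlipTest
    by_cases h : w ∈ blockMap e ⁻¹' rejectionRegion W α m <;> simp [Set.indicator, h]
  · have := hP.1
    unfold expect signFlipTest
    rw [integral_indicator_one hR]
    refine ENNReal.toReal_le_of_le_ofReal hα.le ?_
    rw [(measurePreserving_blockMap e P).measure_preimage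
      (measurableSet_rejectionRegion hW α).nullMeasurableSet]
    exact measure_rejectionRegion_le (measurePreserving_swapSnd_of_mem_nullSpace hP) hW hWs hα

lemma expect_one_sub_signFlipTest_le {W : (𝒳 × 𝒴) × (𝒳 × 𝒴) → ι → ℝ} (hW : Measurable W)
    {α c : ℝ} (hc : 0 ≤ c) (e : (Fin m ⊕ Fin m) ⊕ (Fin m ⊕ Fin m) ↪ Fin n) (P : Measure (𝒳 × 𝒴))
    [IsProbabilityMeasure P]
    (h : ((Measure.pi fun _ : Fin m => P.prod P).prod (Measure.pi fun _ : Fin m => P.prod P))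
      (rejectionRegion W α m)ᶜ ≤ ENNReal.ofReal c) :
    expect P (fun w => 1 - signFlipTest W α e w) ≤ c := by
  have h1 : (fun w => 1 - signFlipTest W α e w)
      = (blockMap e ⁻¹' (rejectionRegion W α m)ᶜ).indicator 1 := by
    ext w
    unfold signFlipTest
    by_cases h : blockMap e w ∈ rejectionRegion W α m <;> simp [Set.indicator, h]
  unfold expect
  rw [h1, integral_indicator_one
    (measurable_blockMap e (measurableSet_rejectionRegion hW α).compl)]
  refine ENNReal.toReal_le_of_le_ofReal hc ?_
  rw [(measurePreserving_blockMap e P).measure_preimage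
    (measurableSet_rejectionRegion hW α).compl.nullMeasurableSet]
  exact h

end Swap

/-! ### Mean and second moment of the contrasts. -/

section Contrast

variable {𝒳 : Type u} {𝒴 : Type v}

/-- The interaction contrast of `g` over the rectangle spanned by two observations. -/
noncomputable def contrast (g : 𝒳 × 𝒴 → ℝ) (q : (𝒳 × 𝒴) × (𝒳 × 𝒴)) : ℝ :=
  (g q.1 + g q.2 - (g (swapSnd q).1 + g (swapSnd q).2)) / 2

lemma contrast_swapSnd (g : 𝒳 × 𝒴 → ℝ) (q : (𝒳 × 𝒴) × (𝒳 × 𝒴)) :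
    contrast g (swapSnd q) = - contrast g q := by
  simp only [contrast, swapSnd]
  ring

lemma contrast_sum {ι : Type*} [Fintype ι] (G : ι → 𝒳 × 𝒴 → ℝ) (s : ι → ℝ)
    (q : (𝒳 × 𝒴) × (𝒳 × 𝒴)) :
    (fun a => contrast (G a) q) ⬝ᵥ s = contrast (fun z => ∑ a, G a z * s a) q := by
  unfold contrast dotProduct
  rw [← Finset.sum_add_distrib, ← Finset.sum_add_distrib, ← Finset.sum_sub_distrib,
    Finset.sum_div]
  exact Finset.sum_congr rfl fun a _ => by ring

variable [MeasurableSpace 𝒳] [MeasurableSpace 𝒴]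

lemma measurable_contrast {g : 𝒳 × 𝒴 → ℝ} (hg : Measurable g) : Measurable (contrast g) := by
  unfold contrast swapSnd
  fun_prop

variable {P : Measure (𝒳 × 𝒴)} [IsProbabilityMeasure P]

lemma measurePreserving_swapSnd_fst :
    MeasurePreserving (fun q : (𝒳 × 𝒴) × (𝒳 × 𝒴) => (swapSnd q).1) (P.prod P)
      ((P.map Prod.fst).prod (P.map Prod.snd)) :=
  have := Measure.isProbabilityMeasure_map (μ := P) measurable_fst.aemeasurable
  have := Measure.isProbabilityMeasure_map (μ := P) measurable_snd.aemeasurable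
  (measurable_fst.measurePreserving P).prod (measurable_snd.measurePreserving P)

lemma measurePreserving_swapSnd_snd :
    MeasurePreserving (fun q : (𝒳 × 𝒴) × (𝒳 × 𝒴) => (swapSnd q).2) (P.prod P)
      ((P.map Prod.fst).prod (P.map Prod.snd)) :=
  measurePreserving_swapSnd_fst.comp (Measure.measurePreserving_swap (μ := P) (ν := P))

variable {g : 𝒳 × 𝒴 → ℝ}

lemma memLp_contrast (h1 : MemLp g 2 P)
    (h2 : MemLp g 2 ((P.map Prod.fst).prod (P.map Prod.snd))) :
    MemLp (contrast g) 2 (P.prod P) := by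
  have a1 := h1.comp_measurePreserving (measurePreserving_fst (μ := P) (ν := P))
  have a2 := h1.comp_measurePreserving (measurePreserving_snd (μ := P) (ν := P))
  have a3 := h2.comp_measurePreserving (measurePreserving_swapSnd_fst (P := P))
  have a4 := h2.comp_measurePreserving (measurePreserving_swapSnd_snd (P := P))
  have := ((a1.add a2).sub (a3.add a4)).mul_const (2⁻¹ : ℝ)
  exact this

lemma integral_comp_of_measurePreserving {α β : Type*} [MeasurableSpace α] [MeasurableSpace β]
    {μ : Measure α} {ν : Measure β} {φ : α → β} (hφ : MeasurePreserving φ μ ν) {h : β → ℝ}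
    (hh : AEStronglyMeasurable h ν) : ∫ x, h (φ x) ∂μ = ∫ y, h y ∂ν := by
  rw [← hφ.map_eq] at hh ⊢
  exact (integral_map hφ.aemeasurable hh).symm

/-- The two original pairs have law `P`, while each swapped pair combines components of independent
observations and so follows the product of the marginals. -/
lemma integral_contrast (h1 : Integrable g P)
    (h2 : Integrable g ((P.map Prod.fst).prod (P.map Prod.snd))) :
    ∫ q, contrast g q ∂(P.prod P) =
      ∫ z, g z ∂P - ∫ z, g z ∂((P.map Prod.fst).prod (P.map Prod.snd)) := by
  have m1 := measurePreserving_fst (μ := P) (ν := P)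
  have m2 := measurePreserving_snd (μ := P) (ν := P)
  have m3 := measurePreserving_swapSnd_fst (P := P)
  have m4 := measurePreserving_swapSnd_snd (P := P)
  have i1 := m1.integrable_comp_of_integrable h1
  have i2 := m2.integrable_comp_of_integrable h1
  have i3 := m3.integrable_comp_of_integrable h2
  have i4 := m4.integrable_comp_of_integrable h2
  have e1 := integral_comp_of_measurePreserving m1 h1.1
  have e2 := integral_comp_of_measurePreserving m2 h1.1
  have e3 := integral_comp_of_measurePreserving m3 h2.1
  have e4 := integral_comp_of_measurePreserving m4 h2.1
  have s1 := integral_sub (i1.add i2) (i3.add i4)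
  have s2 := integral_add i1 i2
  have s3 := integral_add i3 i4
  simp only [Function.comp_def, Pi.add_apply] at s1 s2 s3
  unfold contrast
  rw [integral_div, s1, s2, s3, e1, e2, e3, e4]
  ring

/-- Cauchy–Schwarz for four terms: the square of half a signed sum is at most the sum of the
squares. -/
lemma integral_contrast_sq_le (h1 : MemLp g 2 P)
    (h2 : MemLp g 2 ((P.map Prod.fst).prod (P.map Prod.snd))) :
    ∫ q, contrast g q ^ 2 ∂(P.prod P) ≤
      2 * ∫ z, g z ^ 2 ∂P + 2 * ∫ z, g z ^ 2 ∂((P.map Prod.fst).prod (P.map Prod.snd)) := by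
  have m1 := measurePreserving_fst (μ := P) (ν := P)
  have m2 := measurePreserving_snd (μ := P) (ν := P)
  have m3 := measurePreserving_swapSnd_fst (P := P)
  have m4 := measurePreserving_swapSnd_snd (P := P)
  have i1 := m1.integrable_comp_of_integrable h1.integrable_sq
  have i2 := m2.integrable_comp_of_integrable h1.integrable_sq
  have i3 := m3.integrable_comp_of_integrable h2.integrable_sq
  have i4 := m4.integrable_comp_of_integrable h2.integrable_sq
  have e1 := integral_comp_of_measurePreserving m1 h1.integrable_sq.1
  have e2 := integral_comp_of_measurePreserving m2 h1.integrable_sq.1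
  have e3 := integral_comp_of_measurePreserving m3 h2.integrable_sq.1
  have e4 := integral_comp_of_measurePreserving m4 h2.integrable_sq.1
  calc ∫ q, contrast g q ^ 2 ∂(P.prod P)
      ≤ ∫ q, ((g q.1 ^ 2 + g q.2 ^ 2) + (g (swapSnd q).1 ^ 2 + g (swapSnd q).2 ^ 2))
          ∂(P.prod P) := by
        refine integral_mono (memLp_contrast h1 h2).integrable_sq
          ((i1.add i2).add (i3.add i4)) fun q => ?_
        simp only [contrast]
        generalize g q.1 = a, g q.2 = b, g (swapSnd q).1 = c, g (swapSnd q).2 = d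
        nlinarith [sq_nonneg (a - b), sq_nonneg (c - d), sq_nonneg (a + b + (c + d))]
    _ = _ := by
        have s1 := integral_add (i1.add i2) (i3.add i4)
        have s2 := integral_add i1 i2
        have s3 := integral_add i3 i4
        simp only [Function.comp_def, Pi.add_apply] at s1 s2 s3
        rw [s1, s2, s3, e1, e2, e3, e4]
        ring

lemma integral_le_mul_of_le_smul {α : Type*} [MeasurableSpace α] {μ ν : Measure α} {c : ℝ}
    (hc : 0 ≤ c) (h : ν ≤ ENNReal.ofReal c • μ) {φ : α → ℝ} (hφ : 0 ≤ φ) (hi : Integrable φ μ) :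
    ∫ x, φ x ∂ν ≤ c * ∫ x, φ x ∂μ := by
  refine (integral_mono_measure h (Filter.Eventually.of_forall hφ)
    (hi.smul_measure ENNReal.ofReal_ne_top)).trans (le_of_eq ?_)
  rw [integral_smul_measure, ENNReal.toReal_ofReal hc, smul_eq_mul]

lemma prod_le_smul_prod {μX : Measure 𝒳} {μY : Measure 𝒴} [SigmaFinite μX] [SigmaFinite μY]
    {QX : Measure 𝒳} {QY : Measure 𝒴} [IsProbabilityMeasure QX] [IsProbabilityMeasure QY] {A : ℝ}
    (hA : 0 ≤ A) (hX : QX ≤ ENNReal.ofReal A • μX) (hY : QY ≤ ENNReal.ofReal A • μY) :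
    QX.prod QY ≤ ENNReal.ofReal (A ^ 2) • μX.prod μY := by
  rw [Measure.le_iff]
  intro s hs
  rw [Measure.prod_apply hs, Measure.smul_apply, Measure.prod_apply hs, smul_eq_mul,
    sq, ENNReal.ofReal_mul hA, mul_assoc]
  calc ∫⁻ x, QY (Prod.mk x ⁻¹' s) ∂QX
      ≤ ∫⁻ x, ENNReal.ofReal A * μY (Prod.mk x ⁻¹' s) ∂QX :=
        lintegral_mono fun x => hY _
    _ = ENNReal.ofReal A * ∫⁻ x, μY (Prod.mk x ⁻¹' s) ∂QX :=
        lintegral_const_mul' _ _ ENNReal.ofReal_ne_top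
    _ ≤ ENNReal.ofReal A * (ENNReal.ofReal A * ∫⁻ x, μY (Prod.mk x ⁻¹' s) ∂μX) := by
        gcongr
        refine (lintegral_mono' hX le_rfl).trans ?_
        rw [lintegral_smul_measure, smul_eq_mul]

/-- The moments of the contrast vector of a finite family that is orthonormal with respect to a
measure which dominates both the law `P` and the product of its marginals. -/
lemma integral_contrast_dotProduct_sq_le {ι : Type*} [Fintype ι] {μ : Measure (𝒳 × 𝒴)}
    {G : ι → 𝒳 × 𝒴 → ℝ} (hG : ∀ a, MemLp (G a) 2 μ)
    (hs : ∀ s : ι → ℝ, ∫ z, (∑ a, G a z * s a) ^ 2 ∂μ = s ⬝ᵥ s) {A : ℝ} (hA : 0 ≤ A)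
    (h1 : P ≤ ENNReal.ofReal A • μ)
    (h2 : (P.map Prod.fst).prod (P.map Prod.snd) ≤ ENNReal.ofReal (A ^ 2) • μ) (s : ι → ℝ) :
    ∫ q, ((fun a => contrast (G a) q) ⬝ᵥ s) ^ 2 ∂(P.prod P) ≤ (2 * A + 2 * A ^ 2) * (s ⬝ᵥ s) := by
  simp_rw [contrast_sum]
  have hg : MemLp (fun z => ∑ a, G a z * s a) 2 μ :=
    memLp_finsetSum _ fun a _ => (hG a).mul_const (s a)
  refine (integral_contrast_sq_le (hg.of_measure_le_smul ENNReal.ofReal_ne_top h1)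
    (hg.of_measure_le_smul ENNReal.ofReal_ne_top h2)).trans ?_
  have k1 := integral_le_mul_of_le_smul hA h1 (fun z => sq_nonneg _) hg.integrable_sq
  have k2 := integral_le_mul_of_le_smul (sq_nonneg A) h2 (fun z => sq_nonneg _) hg.integrable_sq
  rw [hs] at k1 k2
  linarith

end Contrast

/-! ### Parseval's identity and orthonormality for product functions. -/

section ProductBasis

variable {𝒳 : Type u} {𝒴 : Type v} [MeasurableSpace 𝒳] [MeasurableSpace 𝒴]
  {μX : Measure 𝒳} {μY : Measure 𝒴} {J K : Type*}

lemma memLp_mul_prod [SigmaFinite μX] [SigmaFinite μY] {p : 𝒳 → ℝ} {q : 𝒴 → ℝ}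
    (hp : MemLp p 2 μX) (hq : MemLp q 2 μY) :
    MemLp (fun z : 𝒳 × 𝒴 => p z.1 * q z.2) 2 (μX.prod μY) := by
  have hm : AEStronglyMeasurable (fun z : 𝒳 × 𝒴 => p z.1 * q z.2) (μX.prod μY) :=
    hp.1.comp_fst.mul hq.1.comp_snd
  rw [memLp_two_iff_integrable_sq hm]
  simp_rw [mul_pow]
  exact hp.integrable_sq.mul_prod hq.integrable_sq

lemma lintegral_sq_eq_tsum (b : HilbertBasis J ℝ (Lp ℝ 2 μX)) {g : 𝒳 → ℝ} (hg : MemLp g 2 μX) :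
    ∫⁻ x, ENNReal.ofReal (g x ^ 2) ∂μX
      = ∑' j, ENNReal.ofReal ((∫ x, g x * b j x ∂μX) ^ 2) := by
  have hin : ∀ j, inner ℝ (hg.toLp g) (b j) = ∫ x, g x * b j x ∂μX := by
    intro j
    rw [L2.inner_def]
    refine integral_congr_ae ?_
    filter_upwards [hg.coeFn_toLp] with x hx
    rw [hx, real_inner_eq_re_inner]
    simp [mul_comm]
  have hself : inner ℝ (hg.toLp g) (hg.toLp g) = ∫ x, g x ^ 2 ∂μX := by
    rw [L2.inner_def]
    refine integral_congr_ae ?_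
    filter_upwards [hg.coeFn_toLp] with x hx
    rw [hx]
    simp
  have hs := b.hasSum_inner_mul_inner (hg.toLp g) (hg.toLp g)
  simp_rw [real_inner_comm (hg.toLp g) (b _), hin, ← sq] at hs
  rw [hself] at hs
  rw [← ofReal_integral_eq_lintegral_ofReal hg.integrable_sq
    (Filter.Eventually.of_forall fun x => sq_nonneg _), ← hs.tsum_eq,
    ENNReal.ofReal_tsum_of_nonneg (fun j => sq_nonneg _) hs.summable]

lemma integral_mul_basis [DecidableEq J] (b : HilbertBasis J ℝ (Lp ℝ 2 μX)) (i j : J) :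
    ∫ x, b i x * b j x ∂μX = if i = j then 1 else 0 := by
  have h := orthonormal_iff_ite.1 b.orthonormal i j
  rw [L2.inner_def] at h
  rw [← h]
  refine integral_congr_ae (Filter.Eventually.of_forall fun x => ?_)
  simp [mul_comm]

/-- Parseval's identity for the product of two bases. -/
theorem lintegral_sq_prod_eq_tsum [SigmaFinite μX] [SigmaFinite μY] [Countable K]
    (bX : HilbertBasis J ℝ (Lp ℝ 2 μX)) (bY : HilbertBasis K ℝ (Lp ℝ 2 μY))
    {h : 𝒳 × 𝒴 → ℝ} (hh : MemLp h 2 (μX.prod μY)) :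
    ∫⁻ z, ENNReal.ofReal (h z ^ 2) ∂(μX.prod μY)
      = ∑' j, ∑' k, ENNReal.ofReal ((∫ z, h z * (bX j z.1 * bY k z.2) ∂(μX.prod μY)) ^ 2) := by
  have hsq := hh.integrable_sq
  have hmem : ∀ᵐ x ∂μX, MemLp (fun y => h (x, y)) 2 μY := by
    filter_upwards [hsq.prod_right_ae, hh.1.prodMk_left] with x h1 h2
    exact (memLp_two_iff_integrable_sq h2).2 h1
  have hfin : ∫⁻ z, ENNReal.ofReal (h z ^ 2) ∂(μX.prod μY) < ⊤ := by
    have := hsq.2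
    rwa [hasFiniteIntegral_iff_ofReal (Filter.Eventually.of_forall fun z => sq_nonneg _)] at this
  have hmeas : ∀ k, AEStronglyMeasurable (fun x => ∫ y, h (x, y) * bY k y ∂μY) μX := fun k =>
    (hh.1.mul (Lp.aestronglyMeasurable (bY k)).comp_snd).integral_prod_right'
  -- Parseval is used in `y` on almost every section, then in `x` on each coefficient function, so
  -- completeness of the product system need not be shown separately.
  have hprod : ∫⁻ z, ENNReal.ofReal (h z ^ 2) ∂(μX.prod μY)
      = ∑' k, ∫⁻ x, ENNReal.ofReal ((∫ y, h (x, y) * bY k y ∂μY) ^ 2) ∂μX := by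
    rw [lintegral_prod _ hsq.1.aemeasurable.ennreal_ofReal,
      ← lintegral_tsum fun k => ((hmeas k).aemeasurable.pow_const 2).ennreal_ofReal]
    refine lintegral_congr_ae ?_
    filter_upwards [hmem] with x hx
    exact lintegral_sq_eq_tsum bY hx
  rw [ENNReal.tsum_comm, hprod]
  refine tsum_congr fun k => ?_
  -- Its squared norm is one term of a series in `[0, ∞]` with finite sum.
  have hk : MemLp (fun x => ∫ y, h (x, y) * bY k y ∂μY) 2 μX := by
    rw [memLp_two_iff_integrable_sq (hmeas k)]
    refine ⟨(hmeas k).pow 2, ?_⟩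
    rw [hasFiniteIntegral_iff_ofReal (Filter.Eventually.of_forall fun z => sq_nonneg _)]
    exact lt_of_le_of_lt ((ENNReal.le_tsum k).trans hprod.ge) hfin
  rw [lintegral_sq_eq_tsum bX hk]
  refine tsum_congr fun j => ?_
  have hi : Integrable (fun z => h z * (bX j z.1 * bY k z.2)) (μX.prod μY) :=
    hh.integrable_mul (memLp_mul_prod (Lp.memLp (bX j)) (Lp.memLp (bY k)))
  rw [integral_prod _ hi]
  congr 3
  ext x
  rw [← integral_mul_const]
  congr 1
  ext y
  ring

/-- The product basis function `p_j^X(x) p_k^Y(y)`, for the index `a = (j, k)`. -/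
noncomputable def prodBasis (bX : HilbertBasis J ℝ (Lp ℝ 2 μX))
    (bY : HilbertBasis K ℝ (Lp ℝ 2 μY)) (a : J × K) (z : 𝒳 × 𝒴) : ℝ :=
  bX a.1 z.1 * bY a.2 z.2

variable (bX : HilbertBasis J ℝ (Lp ℝ 2 μX)) (bY : HilbertBasis K ℝ (Lp ℝ 2 μY))

lemma measurable_prodBasis (a : J × K) : Measurable (prodBasis bX bY a) :=
  ((Lp.stronglyMeasurable (bX a.1)).measurable.comp measurable_fst).mul
    ((Lp.stronglyMeasurable (bY a.2)).measurable.comp measurable_snd)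

variable [SigmaFinite μX] [SigmaFinite μY]

lemma memLp_prodBasis (a : J × K) : MemLp (prodBasis bX bY a) 2 (μX.prod μY) :=
  memLp_mul_prod (Lp.memLp (bX a.1)) (Lp.memLp (bY a.2))

lemma integral_prodBasis_mul [DecidableEq J] [DecidableEq K] (a c : J × K) :
    ∫ z, prodBasis bX bY a z * prodBasis bX bY c z ∂(μX.prod μY) = if a = c then 1 else 0 := by
  have : ∀ z : 𝒳 × 𝒴, prodBasis bX bY a z * prodBasis bX bY c z
      = (bX a.1 z.1 * bX c.1 z.1) * (bY a.2 z.2 * bY c.2 z.2) := fun z => by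
    unfold prodBasis; ring
  simp_rw [this]
  rw [integral_prod_mul (fun x => bX a.1 x * bX c.1 x) fun y => bY a.2 y * bY c.2 y,
    integral_mul_basis, integral_mul_basis]
  simp only [Prod.ext_iff]
  split_ifs <;> simp_all

lemma integral_sum_prodBasis_sq (F : Finset (J × K)) (s : F → ℝ) :
    ∫ z, (∑ a : F, prodBasis bX bY a z * s a) ^ 2 ∂(μX.prod μY) = s ⬝ᵥ s := by
  classical
  have h : ∀ z : 𝒳 × 𝒴, (∑ a : F, prodBasis bX bY a z * s a) ^ 2
      = ∑ a : F, ∑ c : F, prodBasis bX bY a z * prodBasis bX bY c z * (s a * s c) := by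
    intro z
    rw [sq, Finset.sum_mul_sum]
    exact Finset.sum_congr rfl fun a _ => Finset.sum_congr rfl fun c _ => by ring
  have hi : ∀ a c : F, Integrable (fun z => prodBasis bX bY a z * prodBasis bX bY c z
      * (s a * s c)) (μX.prod μY) := fun a c =>
    ((memLp_prodBasis bX bY a).integrable_mul (memLp_prodBasis bX bY c)).mul_const _
  simp_rw [h]
  rw [integral_finsetSum _ fun a _ => integrable_finsetSum _ fun c _ => hi a c]
  simp_rw [integral_finsetSum _ fun c _ => hi _ c, integral_mul_const, integral_prodBasis_mul]
  simp [dotProduct, SetLike.coe_eq_coe]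

end ProductBasis

/-! ### Laws with bounded densities, their marginals and their coefficients. -/

section Densities

variable {𝒳 : Type u} {𝒴 : Type v} [MeasurableSpace 𝒳] [MeasurableSpace 𝒴]
  {μX : Measure 𝒳} {μY : Measure 𝒴} {f : 𝒳 × 𝒴 → ℝ} {A : ℝ}

lemma abs_le_of_supNorm_le {Z : Type*} {g : Z → ℝ} (hA : 0 ≤ A)
    (h : supNorm g ≤ ENNReal.ofReal A) (z : Z) : |g z| ≤ A :=
  (ENNReal.ofReal_le_ofReal_iff hA).1 ((le_iSup (fun z => ENNReal.ofReal |g z|) z).trans h)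

lemma integrable_of_mem_densities (hf : f ∈ densities μX μY) : Integrable f (μX.prod μY) := by
  -- The Bochner integral of a non-integrable function is `0` by convention, which contradicts total
  -- mass `1`.
  by_contra h
  have := hf.2.2
  rw [integral_undef h] at this
  exact zero_ne_one this

lemma isProbabilityMeasure_law (hf : f ∈ densities μX μY) :
    IsProbabilityMeasure (law μX μY f) := by
  constructor
  rw [law, withDensity_apply _ MeasurableSet.univ, Measure.restrict_univ,
    ← ofReal_integral_eq_lintegral_ofReal (integrable_of_mem_densities hf) hf.2.1, hf.2.2,
    ENNReal.ofReal_one]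

lemma law_le_smul (hfA : ∀ z, |f z| ≤ A) :
    law μX μY f ≤ ENNReal.ofReal A • μX.prod μY := by
  rw [law, ← withDensity_const]
  exact withDensity_mono (Filter.Eventually.of_forall fun z =>
    ENNReal.ofReal_le_ofReal ((le_abs_self _).trans (hfA z)))

lemma aemeasurable_density (hf : f ∈ densities μX μY) :
    AEMeasurable (fun z => ENNReal.ofReal (f z)) (μX.prod μY) :=
  hf.1.1.aemeasurable.ennreal_ofReal

lemma integral_law (hf : f ∈ densities μX μY) (g : 𝒳 × 𝒴 → ℝ) :
    ∫ z, g z ∂(law μX μY f) = ∫ z, f z * g z ∂(μX.prod μY) := by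
  rw [law, integral_withDensity_eq_integral_toReal_smul₀ (aemeasurable_density hf)
    (Filter.Eventually.of_forall fun z => ENNReal.ofReal_lt_top)]
  refine integral_congr_ae ?_
  filter_upwards [hf.2.1] with z hz
  rw [ENNReal.toReal_ofReal hz, smul_eq_mul]

lemma integrable_density_mul (hf : f ∈ densities μX μY) {g : 𝒳 × 𝒴 → ℝ}
    (hg : Integrable g (law μX μY f)) : Integrable (fun z => f z * g z) (μX.prod μY) := by
  rw [law, integrable_withDensity_iff_integrable_smul₀' (aemeasurable_density hf)
    (Filter.Eventually.of_forall fun z => ENNReal.ofReal_lt_top)] at hg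
  refine hg.congr ?_
  filter_upwards [hf.2.1] with z hz
  rw [ENNReal.toReal_ofReal hz, smul_eq_mul]

variable [SigmaFinite μX] [SigmaFinite μY]

lemma map_fst_law_le_smul (hf : f ∈ densities μX μY) (hX : ∀ x, |marginalX μY f x| ≤ A) :
    (law μX μY f).map Prod.fst ≤ ENNReal.ofReal A • μX := by
  rw [Measure.le_iff]
  intro s hs
  have hint := integrable_of_mem_densities hf
  rw [Measure.map_apply measurable_fst hs, law, withDensity_apply _ (measurable_fst hs),
    ← Set.prod_univ, ← Measure.prod_restrict, Measure.restrict_univ,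
    lintegral_prod _ ((aemeasurable_density hf).mono_measure
      (Measure.prod_mono Measure.restrict_le_self le_rfl)), Measure.smul_apply, smul_eq_mul,
    ← setLIntegral_const]
  refine lintegral_mono_ae (ae_restrict_of_ae ?_)
  filter_upwards [hint.prod_right_ae, Measure.ae_ae_of_ae_prod hf.2.1] with x h1 h2
  rw [← ofReal_integral_eq_lintegral_ofReal h1 h2]
  exact ENNReal.ofReal_le_ofReal ((le_abs_self _).trans (hX x))

/-- Exchanging the roles of the two components preserves the class of densities. -/
lemma comp_swap_mem_densities (hf : f ∈ densities μX μY) : f ∘ Prod.swap ∈ densities μY μX := by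
  have hsw := Measure.measurePreserving_swap (μ := μY) (ν := μX)
  refine ⟨hf.1.comp_measurePreserving hsw, hsw.quasiMeasurePreserving.ae hf.2.1, ?_⟩
  rw [← hf.2.2]
  exact integral_prod_swap f

lemma law_comp_swap (f : 𝒳 × 𝒴 → ℝ) :
    (law μY μX (f ∘ Prod.swap)).map Prod.swap = law μX μY f := by
  ext s hs
  have hsw := Measure.measurePreserving_swap (μ := μY) (ν := μX)
  rw [Measure.map_apply measurable_swap hs, law, law, withDensity_apply _ (measurable_swap hs),
    withDensity_apply _ hs]
  exact hsw.setLIntegral_comp_preimage_emb MeasurableEquiv.prodComm.measurableEmbedding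
    (fun z => ENNReal.ofReal (f z)) s

/-- Transfers facts about the first marginal to the second by symmetry. -/
lemma map_snd_law (f : 𝒳 × 𝒴 → ℝ) :
    (law μX μY f).map Prod.snd = (law μY μX (f ∘ Prod.swap)).map Prod.fst := by
  rw [← law_comp_swap f, Measure.map_map measurable_snd measurable_swap]
  rfl

lemma map_snd_law_le_smul (hf : f ∈ densities μX μY) (hY : ∀ y, |marginalY μX f y| ≤ A) :
    (law μX μY f).map Prod.snd ≤ ENNReal.ofReal A • μY := by
  rw [map_snd_law f]
  exact map_fst_law_le_smul (comp_swap_mem_densities hf) hY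

lemma integral_map_fst_law (hf : f ∈ densities μX μY) (hX : ∀ x, |marginalX μY f x| ≤ A)
    {p : 𝒳 → ℝ} (hp : MemLp p 2 μX) :
    ∫ x, p x ∂((law μX μY f).map Prod.fst) = ∫ x, marginalX μY f x * p x ∂μX := by
  have := isProbabilityMeasure_law hf
  have := Measure.isProbabilityMeasure_map (μ := law μX μY f) measurable_fst.aemeasurable
  have h2 := hp.of_measure_le_smul ENNReal.ofReal_ne_top (map_fst_law_le_smul hf hX)
  have hmp := measurable_fst.measurePreserving (law μX μY f)
  have hi : Integrable (fun z : 𝒳 × 𝒴 => p z.1) (law μX μY f) :=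
    hmp.integrable_comp_of_integrable (h2.integrable (by norm_num))
  rw [← integral_comp_of_measurePreserving hmp h2.1, integral_law hf,
    integral_prod _ (integrable_density_mul hf hi)]
  simp_rw [integral_mul_const]
  rfl

lemma integral_map_snd_law (hf : f ∈ densities μX μY) (hY : ∀ y, |marginalY μX f y| ≤ A)
    {q : 𝒴 → ℝ} (hq : MemLp q 2 μY) :
    ∫ y, q y ∂((law μX μY f).map Prod.snd) = ∫ y, marginalY μX f y * q y ∂μY := by
  rw [map_snd_law f]
  exact integral_map_fst_law (comp_swap_mem_densities hf) hY hq

-- The marginal is integrable and bounded by `A`, so its square is dominated by `A` times its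
-- absolute value.
omit [SigmaFinite μX] in
lemma memLp_marginalX (hf : f ∈ densities μX μY) (hX : ∀ x, |marginalX μY f x| ≤ A) :
    MemLp (marginalX μY f) 2 μX := by
  have h1 : Integrable (marginalX μY f) μX := (integrable_of_mem_densities hf).integral_prod_left
  rw [memLp_two_iff_integrable_sq h1.1]
  refine (h1.norm.const_mul A).mono' (h1.1.pow 2) (Filter.Eventually.of_forall fun x => ?_)
  rw [norm_pow, sq]
  exact mul_le_mul_of_nonneg_right (hX x) (norm_nonneg _)

lemma memLp_marginalY (hf : f ∈ densities μX μY) (hY : ∀ y, |marginalY μX f y| ≤ A) :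
    MemLp (marginalY μX f) 2 μY :=
  memLp_marginalX (comp_swap_mem_densities hf) hY

variable {J K : Type*} (bX : HilbertBasis J ℝ (Lp ℝ 2 μX)) (bY : HilbertBasis K ℝ (Lp ℝ 2 μY))

/-- The dependence measure is the sum of the squared interaction coefficients. -/
theorem ofReal_dependence_eq_tsum [Countable K] (hf : f ∈ densities μX μY)
    (hX : ∀ x, |marginalX μY f x| ≤ A) (hY : ∀ y, |marginalY μX f y| ≤ A) :
    ENNReal.ofReal (dependence μX μY f) = ∑' j, ∑' k,
      ENNReal.ofReal ((coeff bX bY f j k - coeffX bX μY f j * coeffY μX bY f k) ^ 2) := by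
  have h2 := memLp_mul_prod (memLp_marginalX hf hX) (memLp_marginalY hf hY)
  have h3 : MemLp (fun z : 𝒳 × 𝒴 => f z - marginalX μY f z.1 * marginalY μX f z.2) 2
    (μX.prod μY) := hf.1.sub h2
  rw [dependence, ofReal_integral_eq_lintegral_ofReal h3.integrable_sq
    (Filter.Eventually.of_forall fun z => sq_nonneg _), lintegral_sq_prod_eq_tsum bX bY h3]
  refine tsum_congr fun j => tsum_congr fun k => ?_
  have hp := memLp_prodBasis bX bY (j, k)
  congr 2
  simp_rw [sub_mul]
  have e1 := integral_sub (hf.1.integrable_mul hp) (h2.integrable_mul hp)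
  simp only [Pi.mul_apply, prodBasis] at e1
  rw [e1, coeff, coeffX, coeffY,
    ← integral_prod_mul (fun x => marginalX μY f x * bX j x) fun y => marginalY μX f y * bY k y]
  congr 2
  ext z
  ring

lemma integral_contrast_prodBasis (hf : f ∈ densities μX μY) (hfA : ∀ z, |f z| ≤ A) (hA : 0 ≤ A)
    (hX : ∀ x, |marginalX μY f x| ≤ A) (hY : ∀ y, |marginalY μX f y| ≤ A) (a : J × K) :
    ∫ q, contrast (prodBasis bX bY a) q ∂((law μX μY f).prod (law μX μY f))
      = coeff bX bY f a.1 a.2 - coeffX bX μY f a.1 * coeffY μX bY f a.2 := by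
  have := isProbabilityMeasure_law hf
  have := Measure.isProbabilityMeasure_map (μ := law μX μY f) measurable_fst.aemeasurable
  have := Measure.isProbabilityMeasure_map (μ := law μX μY f) measurable_snd.aemeasurable
  have hp := memLp_prodBasis bX bY a
  have i1 := (hp.of_measure_le_smul ENNReal.ofReal_ne_top (law_le_smul hfA)).integrable
    (by norm_num)
  have i2 := (hp.of_measure_le_smul ENNReal.ofReal_ne_top (prod_le_smul_prod hA
    (map_fst_law_le_smul hf hX) (map_snd_law_le_smul hf hY))).integrable (by norm_num)
  rw [integral_contrast i1 i2, integral_law hf]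
  unfold prodBasis
  rw [integral_prod_mul (fun x => bX a.1 x) fun y => bY a.2 y,
    integral_map_fst_law hf hX (Lp.memLp (bX a.1)), integral_map_snd_law hf hY (Lp.memLp (bY a.2))]
  rfl

end Densities

/-! ### Truncation to finitely many coefficients. -/

section Truncation

variable {𝒳 : Type u} {𝒴 : Type v} [MeasurableSpace 𝒳] [MeasurableSpace 𝒴]
  {μX : Measure 𝒳} {μY : Measure 𝒴} {J K : Type*} (bX : HilbertBasis J ℝ (Lp ℝ 2 μX)) (bY : HilbertBasis K ℝ (Lp ℝ 2 μY))

/-- The interaction coefficients `a_{jk} - a_{j•} a_{•k}`. -/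
noncomputable def interaction (f : 𝒳 × 𝒴 → ℝ) (a : J × K) : ℝ :=
  coeff bX bY f a.1 a.2 - coeffX bX μY f a.1 * coeffY μX bY f a.2

/-- The vector of contrasts of the basis functions with index in `F`. -/
noncomputable def contrastVector (F : Finset (J × K)) (q : (𝒳 × 𝒴) × (𝒳 × 𝒴)) (a : F) : ℝ :=
  contrast (prodBasis bX bY a) q

lemma measurable_contrastVector (F : Finset (J × K)) : Measurable (contrastVector bX bY F) :=
  measurable_pi_lambda _ fun a => measurable_contrast (measurable_prodBasis bX bY a)

lemma contrastVector_swapSnd (F : Finset (J × K)) (q : (𝒳 × 𝒴) × (𝒳 × 𝒴)) :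
    contrastVector bX bY F (swapSnd q) = - contrastVector bX bY F q := by
  ext a
  exact contrast_swapSnd _ _

variable [SigmaFinite μX] [SigmaFinite μY]

/-- Outside `F` each squared coefficient is at most `T⁻²` times its weighted version, and these sum
to at most `r²`. Working in `[0, ∞]` treats infinite weights uniformly. -/
lemma dependence_le_truncation_add [Countable K] {f : 𝒳 × 𝒴 → ℝ} {A r T : ℝ}
    {θ : J → K → ℝ≥0∞} (hf : f ∈ densities μX μY)
    (hX : ∀ x, |marginalX μY f x| ≤ A) (hY : ∀ y, |marginalY μX f y| ≤ A)
    (hS : smoothness bX bY θ f ≤ ENNReal.ofReal (r ^ 2)) (hT : 0 < T) (F : Finset (J × K))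
    (hF : ∀ a ∉ F, ENNReal.ofReal T ≤ θ a.1 a.2) :
    dependence μX μY f ≤ ∑ a ∈ F, interaction bX bY f a ^ 2 + r ^ 2 / T ^ 2 := by
  classical
  set g : J × K → ℝ≥0∞ := fun a => ENNReal.ofReal (interaction bX bY f a ^ 2) with hg
  have hD : ENNReal.ofReal (dependence μX μY f) = ∑' a, g a := by
    rw [ofReal_dependence_eq_tsum bX bY hf hX hY, ENNReal.tsum_prod']
    rfl
  have hS' : ∑' a : J × K, θ a.1 a.2 ^ 2 * g a ≤ ENNReal.ofReal (r ^ 2) := by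
    rw [ENNReal.tsum_prod']
    exact hS
  have hpt : ∀ a, g a ≤ (F : Set (J × K)).indicator g a
      + ENNReal.ofReal (1 / T ^ 2) * (θ a.1 a.2 ^ 2 * g a) := by
    intro a
    by_cases ha : a ∈ F
    · rw [Set.indicator_of_mem (Finset.mem_coe.2 ha)]
      exact le_self_add
    · rw [Set.indicator_of_notMem (fun h => ha (Finset.mem_coe.1 h)), zero_add, ← mul_assoc]
      have h1 : 1 ≤ ENNReal.ofReal (1 / T ^ 2) * θ a.1 a.2 ^ 2 := by
        calc (1 : ℝ≥0∞) = ENNReal.ofReal (1 / T ^ 2) * ENNReal.ofReal T ^ 2 := by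
              rw [← ENNReal.ofReal_pow hT.le, ← ENNReal.ofReal_mul (by positivity),
                one_div_mul_cancel (by positivity), ENNReal.ofReal_one]
          _ ≤ _ := by
              gcongr
              exact hF a ha
      simpa using mul_le_mul_left h1 (g a)
  have hsum : ∑ a ∈ F, g a = ENNReal.ofReal (∑ a ∈ F, interaction bX bY f a ^ 2) :=
    (ENNReal.ofReal_sum_of_nonneg fun a _ => sq_nonneg _).symm
  have hnn : 0 ≤ ∑ a ∈ F, interaction bX bY f a ^ 2 := Finset.sum_nonneg fun a _ => sq_nonneg _
  rw [← ENNReal.ofReal_le_ofReal_iff (by positivity), hD]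
  calc ∑' a, g a ≤ ∑' a, ((F : Set (J × K)).indicator g a
          + ENNReal.ofReal (1 / T ^ 2) * (θ a.1 a.2 ^ 2 * g a)) := ENNReal.tsum_le_tsum hpt
    _ = ∑ a ∈ F, g a + ENNReal.ofReal (1 / T ^ 2) * ∑' a : J × K, θ a.1 a.2 ^ 2 * g a := by
        rw [ENNReal.tsum_add, ENNReal.tsum_mul_left, ← tsum_subtype, Finset.tsum_subtype' F g]
    _ ≤ ENNReal.ofReal (∑ a ∈ F, interaction bX bY f a ^ 2)
          + ENNReal.ofReal (1 / T ^ 2) * ENNReal.ofReal (r ^ 2) := by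
        rw [hsum]
        gcongr
    _ = _ := by
        rw [← ENNReal.ofReal_mul (by positivity), ← ENNReal.ofReal_add hnn (by positivity)]
        congr 2
        ring

/-- The type II error of the sign-flip test based on the basis functions with index in `F`. -/
theorem expect_one_sub_signFlipTest_contrastVector_le {f : 𝒳 × 𝒴 → ℝ} {A α : ℝ} (hα : 0 < α)
    (hA : 0 ≤ A) (hf : f ∈ densities μX μY) (hfA : ∀ z, |f z| ≤ A)
    (hX : ∀ x, |marginalX μY f x| ≤ A) (hY : ∀ y, |marginalY μX f y| ≤ A)
    (F : Finset (J × K)) (hF : 0 < ∑ a ∈ F, interaction bX bY f a ^ 2) {m n : ℕ} (hm : 0 < m)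
    (e : (Fin m ⊕ Fin m) ⊕ (Fin m ⊕ Fin m) ↪ Fin n) :
    expect (law μX μY f) (fun w => 1 - signFlipTest (contrastVector bX bY F) α e w)
      ≤ (12 + 4 / α) * ((2 * A + 2 * A ^ 2) / (m * ∑ a ∈ F, interaction bX bY f a ^ 2)
        + F.card * (2 * A + 2 * A ^ 2) ^ 2 / (m * ∑ a ∈ F, interaction bX bY f a ^ 2) ^ 2) := by
  have := isProbabilityMeasure_law hf
  have := Measure.isProbabilityMeasure_map (μ := law μX μY f) measurable_fst.aemeasurable
  have := Measure.isProbabilityMeasure_map (μ := law μX μY f) measurable_snd.aemeasurable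
  have h1 := law_le_smul (μX := μX) (μY := μY) hfA
  have h2 := prod_le_smul_prod hA (map_fst_law_le_smul hf hX) (map_snd_law_le_smul hf hY)
  have hW := measurable_contrastVector bX bY F
  have hsum : ∑ a ∈ F, interaction bX bY f a ^ 2
      = (fun a : F => interaction bX bY f a) ⬝ᵥ fun a : F => interaction bX bY f a := by
    rw [← Finset.sum_coe_sort]
    exact Finset.sum_congr rfl fun a _ => sq _
  have hcard : (F.card : ℝ) = Fintype.card F := by simp
  rw [hsum] at hF ⊢
  rw [hcard]
  refine expect_one_sub_signFlipTest_le hW (by positivity) e _ ?_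
  refine measure_compl_rejectionRegion_le hW (fun a => ?_) (by positivity) (fun s => ?_)
    (fun a => ?_) hF hm hα
  · exact memLp_contrast ((memLp_prodBasis bX bY a).of_measure_le_smul ENNReal.ofReal_ne_top h1)
      ((memLp_prodBasis bX bY a).of_measure_le_smul ENNReal.ofReal_ne_top h2)
  · exact integral_contrast_dotProduct_sq_le (G := fun a : F => prodBasis bX bY a)
      (fun a => memLp_prodBasis bX bY a) (integral_sum_prodBasis_sq bX bY F) hA h1 h2 s
  · exact integral_contrast_prodBasis bX bY hf hfA hA hX hY a

end Truncation

/-! ### From a single test to the minimax risk. -/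

section Risk

variable {𝒳 : Type u} {𝒴 : Type v} [MeasurableSpace 𝒳] [MeasurableSpace 𝒴]
  {μX : Measure 𝒳} {μY : Measure 𝒴} {J K : Type*}
  (bX : HilbertBasis J ℝ (Lp ℝ 2 μX)) (bY : HilbertBasis K ℝ (Lp ℝ 2 μY))

/-- A valid test with type II error at most `β` bounds the minimax risk. -/
lemma testingRisk_le {n : ℕ} {α β : ℝ} (hβ : 0 ≤ β) {θ : J → K → ℝ≥0∞} {r A ρ : ℝ}
    {ψ : (Fin n → 𝒳 × 𝒴) → ℝ} (hψ : ψ ∈ validTests 𝒳 𝒴 n α)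
    (h : ∀ f ∈ alternatives bX bY θ r A ρ, expect (law μX μY f) (fun w => 1 - ψ w) ≤ β) :
    testingRisk bX bY n α θ r A ρ ≤ α + β := by
  unfold testingRisk
  gcongr
  -- `hβ` covers the empty class of alternatives, where the real supremum is `0`. The infimum bound
  -- needs a lower bound over all tests, here `0`.
  refine (ciInf_le ?_ ⟨ψ, hψ⟩).trans (Real.iSup_le (fun f => h f.1 f.2) hβ)
  refine ⟨0, ?_⟩
  rintro _ ⟨φ, rfl⟩
  exact Real.iSup_nonneg fun f => integral_nonneg fun w => sub_nonneg.2 (φ.2.1.2 w).2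

end Risk

/-! ### Counting the retained multi-indices. -/

section Indices

/-- The nonzero multi-indices of norm at most `t`. -/
noncomputable def indexBall (d : ℕ) (t : ℝ) : Finset (Fin d → ℕ) :=
  (Fintype.piFinset fun _ => Finset.range (⌊t⌋₊ + 1)).filter fun j => j ≠ 0 ∧ multiNorm j ≤ t

lemma coord_le_multiNorm {d : ℕ} (j : Fin d → ℕ) (i : Fin d) : (j i : ℝ) ≤ multiNorm j :=
  Finset.single_le_sum (f := fun i => (j i : ℝ)) (fun i _ => (j i).cast_nonneg) (Finset.mem_univ i)

lemma mem_indexBall {d : ℕ} {t : ℝ} {j : Fin d → ℕ} :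
    j ∈ indexBall d t ↔ j ≠ 0 ∧ multiNorm j ≤ t := by
  unfold indexBall
  simp only [Finset.mem_filter, Fintype.mem_piFinset, Finset.mem_range, and_iff_right_iff_imp]
  rintro ⟨-, h⟩ i
  exact Nat.lt_succ_of_le (Nat.le_floor ((coord_le_multiNorm j i).trans h))

lemma one_le_multiNorm {d : ℕ} {j : Fin d → ℕ} (hj : j ≠ 0) : 1 ≤ multiNorm j := by
  obtain ⟨i, hi⟩ := Function.ne_iff.1 hj
  refine le_trans ?_ (coord_le_multiNorm j i)
  exact_mod_cast Nat.one_le_iff_ne_zero.2 hi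

/-- Leaving out the zero index makes the ball empty for `t < 1`; for `t ≥ 1` the extra `1` in the
side of the enclosing cube is absorbed by the factor `2`. -/
lemma card_indexBall_le {d : ℕ} {t : ℝ} (ht : 0 ≤ t) : ((indexBall d t).card : ℝ) ≤ (2 * t) ^ d := by
  rcases lt_or_ge t 1 with h | h
  · have : indexBall d t = ∅ := by
      refine Finset.eq_empty_of_forall_notMem fun j hj => ?_
      obtain ⟨h0, h1⟩ := mem_indexBall.1 hj
      linarith [one_le_multiNorm h0]
    rw [this]
    simp only [Finset.card_empty, Nat.cast_zero]
    positivity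
  · calc ((indexBall d t).card : ℝ)
        ≤ ((Fintype.piFinset fun _ : Fin d => Finset.range (⌊t⌋₊ + 1)).card : ℝ) := by
          exact_mod_cast Finset.card_filter_le _ _
      _ = (⌊t⌋₊ + 1 : ℝ) ^ d := by simp
      _ ≤ (2 * t) ^ d := by
          gcongr
          linarith [Nat.floor_le ht]

lemma le_rpow_of_rpow_inv_le {s T x : ℝ} (hs : 0 < s) (hT : 0 ≤ T) (h : T ^ (1 / s) ≤ x) :
    T ≤ x ^ s := by
  have := Real.rpow_le_rpow (Real.rpow_nonneg hT _) h hs.le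
  rwa [← Real.rpow_mul hT, one_div_mul_cancel hs.ne', Real.rpow_one] at this

/-- A discarded index has a zero component, hence infinite weight, or one component outside its
ball, which pushes the maximum up to `T`. -/
lemma le_sobolevWeight {dX dY : ℕ} {sX sY T : ℝ} (hsX : 0 < sX) (hsY : 0 < sY) (hT : 0 ≤ T)
    (a : (Fin dX → ℕ) × (Fin dY → ℕ))
    (ha : a ∉ indexBall dX (T ^ (1 / sX)) ×ˢ indexBall dY (T ^ (1 / sY))) :
    ENNReal.ofReal T ≤ sobolevWeight dX dY sX sY a.1 a.2 := by
  unfold sobolevWeight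
  split_ifs with h
  · refine ENNReal.ofReal_le_ofReal ?_
    rw [Finset.mem_product, mem_indexBall, mem_indexBall] at ha
    rcases le_or_gt (multiNorm a.1) (T ^ (1 / sX)) with h1 | h1
    · rcases le_or_gt (multiNorm a.2) (T ^ (1 / sY)) with h2 | h2
      · exact absurd ⟨⟨h.1, h1⟩, h.2, h2⟩ ha
      · exact (le_rpow_of_rpow_inv_le hsY hT h2.le).trans (le_max_right _ _)
    · exact (le_rpow_of_rpow_inv_le hsX hT h1.le).trans (le_max_left _ _)
  · exact le_top

lemma card_indexBall_prod_le {dX dY : ℕ} {sX sY T : ℝ} (hT : 0 < T) :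
    ((indexBall dX (T ^ (1 / sX)) ×ˢ indexBall dY (T ^ (1 / sY))).card : ℝ)
      ≤ 2 ^ (dX + dY) * T ^ (dX / sX + dY / sY) := by
  have h : ∀ (d : ℕ) (s : ℝ), (2 * T ^ (1 / s)) ^ d = 2 ^ d * T ^ (d / s) := by
    intro d s
    rw [mul_pow, ← Real.rpow_natCast (T ^ (1 / s)), ← Real.rpow_mul hT.le]
    congr 2
    ring
  rw [Finset.card_product, Nat.cast_mul, pow_add, Real.rpow_add hT]
  calc ((indexBall dX (T ^ (1 / sX))).card : ℝ) * ((indexBall dY (T ^ (1 / sY))).card : ℝ)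
      ≤ (2 * T ^ (1 / sX)) ^ dX * (2 * T ^ (1 / sY)) ^ dY :=
        mul_le_mul (card_indexBall_le (by positivity)) (card_indexBall_le (by positivity))
          (by positivity) (by positivity)
    _ = _ := by
        rw [h, h]
        ring

end Indices

/-! ### Balancing truncation bias against stochastic error. -/

section Rate

/-- The lower bound and the bias-variance identity satisfied by the separation rate `R`. -/
lemma rate_balance {d s r n R : ℝ} (hd : 0 < d) (hs : 0 < s) (hr : 0 < r) (hn : 0 < n)
    (hnr : 1 ≤ n * r ^ 2) (hR : R = (r ^ d / n ^ (2 * s)) ^ (1 / (4 * s + d))) :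
    0 < R ∧ 1 ≤ n * R ^ 2 ∧ (r / R) ^ (d / s) = (n * R ^ 2) ^ 2 := by
  have hR0 : 0 < R := by rw [hR]; positivity
  -- In logarithms both claims are linear in `log r` and `log n`; the lower bound reduces to `log (n
  -- * r ^ 2) ≥ 0`.
  have hlog : Real.log R = (d * Real.log r - 2 * s * Real.log n) / (4 * s + d) := by
    rw [hR, Real.log_rpow (by positivity), Real.log_div (by positivity) (by positivity),
      Real.log_rpow hr, Real.log_rpow hn]
    ring
  have hlognr : 0 ≤ Real.log n + 2 * Real.log r := by
    have := Real.log_nonneg hnr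
    rwa [Real.log_mul hn.ne' (by positivity), Real.log_pow, Nat.cast_ofNat] at this
  have hx : Real.log (n * R ^ 2) = d * (Real.log n + 2 * Real.log r) / (4 * s + d) := by
    rw [Real.log_mul hn.ne' (by positivity), Real.log_pow, Nat.cast_ofNat, hlog]
    field_simp
    ring
  refine ⟨hR0, ?_, ?_⟩
  · rw [← Real.log_nonneg_iff (by positivity), hx]
    positivity
  · refine Real.log_injOn_pos (Set.mem_Ioi.2 (by positivity)) (Set.mem_Ioi.2 (by positivity)) ?_
    rw [Real.log_rpow (by positivity), Real.log_div hr.ne' hR0.ne', Real.log_pow, Nat.cast_ofNat,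
      hx, hlog]
    field_simp
    ring

/-- The error bound of the sign-flip test is at most `β` at a signal strength of order `x`. -/
lemma errorBound_le {κ B M β K x y N : ℝ} (hκ : 0 ≤ κ) (hB : 0 ≤ B) (hM : 0 ≤ M) (hβ : 0 < β)
    (hK1 : 1 ≤ K) (hK : κ * (16 * B + 256 * M * B ^ 2) / β ≤ K) (hx : 1 ≤ x)
    (hy : K * x / 16 ≤ y) (hN : N ≤ M * x ^ 2) :
    κ * (B / y + N * B ^ 2 / y ^ 2) ≤ β := by
  have hK0 : 0 < K := by linarith
  have hx0 : 0 < x := by linarith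
  have h1 : B / y ≤ 16 * B / K := by
    calc B / y ≤ B / (K * x / 16) := by gcongr
      _ ≤ B / (K * 1 / 16) := by gcongr
      _ = 16 * B / K := by field_simp
  have h2 : N * B ^ 2 / y ^ 2 ≤ 256 * M * B ^ 2 / K := by
    calc N * B ^ 2 / y ^ 2 ≤ (M * x ^ 2) * B ^ 2 / (K * x / 16) ^ 2 := by gcongr
      _ = 256 * M * B ^ 2 / (K * K) := by field_simp; norm_num
      _ ≤ 256 * M * B ^ 2 / (K * 1) := by gcongr
      _ = _ := by rw [mul_one]
  calc κ * (B / y + N * B ^ 2 / y ^ 2) ≤ κ * (16 * B / K + 256 * M * B ^ 2 / K) := by gcongr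
    _ = κ * (16 * B + 256 * M * B ^ 2) / K := by ring
    _ ≤ β := by
        rw [div_le_iff₀ hβ] at hK
        rw [div_le_iff₀ hK0]
        linarith

end Rate

end IndepTesting

/-! ### Choice of the constant and the cut-off. -/

theorem mainTheorem5 (dX dY : ℕ) (hdX : 1 ≤ dX) (hdY : 1 ≤ dY) (α β A : ℝ)
    (hα : 0 < α) (hβ : 0 < β) (hαβ : α + β < 1) (hA : 0 < A) :
    ∃ C : ℝ, 0 < C ∧
      ∀ (𝒳 : Type u) (𝒴 : Type v) [MeasurableSpace 𝒳] [MeasurableSpace 𝒴]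
        (μX : Measure 𝒳) (μY : Measure 𝒴) [SigmaFinite μX] [SigmaFinite μY]
        (bX : HilbertBasis (Fin dX → ℕ) ℝ (Lp ℝ 2 μX))
        (bY : HilbertBasis (Fin dY → ℕ) ℝ (Lp ℝ 2 μY))
        (sX sY r : ℝ) (n : ℕ), 0 < sX → 0 < sY → 0 < r → 16 ≤ n → 1 ≤ n * r ^ 2 →
        ∀ d s : ℝ, d = dX + dY → s = IndepTesting.overallSmoothness dX dY sX sY →
          IndepTesting.separationRadius bX bY n α β
              (IndepTesting.sobolevWeight dX dY sX sY) r A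
            ≤ ENNReal.ofReal (C * (r ^ d / (n : ℝ) ^ (2 * s)) ^ (1 / (4 * s + d))) := by
  open IndepTesting in
  set B : ℝ := 2 * A + 2 * A ^ 2 with hB
  set κ : ℝ := 12 + 4 / α with hκ
  have hB0 : 0 < B := by positivity
  have hκ0 : 0 < κ := by positivity
  -- The summand `2` lets half of the signal `K * R ^ 2` survive the bias `R ^ 2`; the other is what
  -- `errorBound_le` requires with `M = 2 ^ (dX + dY)`.
  set K : ℝ := 2 + κ * (16 * B + 256 * 2 ^ (dX + dY) * B ^ 2) / β with hK
  have hK2 : 2 ≤ K := by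
    have : 0 ≤ κ * (16 * B + 256 * 2 ^ (dX + dY) * B ^ 2) / β := by positivity
    linarith
  refine ⟨√K, Real.sqrt_pos.2 (by linarith), ?_⟩
  intro 𝒳 𝒴 _ _ μX μY _ _ bX bY sX sY r n hsX hsY hr hn hnr d s hd hs
  have hdX0 : (0 : ℝ) < dX := by exact_mod_cast hdX
  have hdY0 : (0 : ℝ) < dY := by exact_mod_cast hdY
  have hd0 : 0 < d := by rw [hd]; positivity
  have he0 : 0 < dX / sX + dY / sY := by positivity
  have hs0 : 0 < s := by rw [hs, overallSmoothness]; positivity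
  have hds : d / s = dX / sX + dY / sY := by
    rw [hs, overallSmoothness, ← hd, div_div_cancel₀ hd0.ne']
  have hn0 : (0 : ℝ) < n := by exact_mod_cast (by omega : 0 < n)
  set R := (r ^ d / (n : ℝ) ^ (2 * s)) ^ (1 / (4 * s + d)) with hR
  obtain ⟨hR0, hx, hT⟩ := rate_balance hd0 hs0 hr hn0 hnr hR
  have hT0 : 0 < r / R := by positivity
  have hC0 : 0 < √K := Real.sqrt_pos.2 (by linarith)
  refine sInf_le ⟨√K * R, by positivity, ?_, rfl⟩
  -- The cut-off `r / R` is the one at which the truncation bias equals `R ^ 2`.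
  set F := indexBall dX ((r / R) ^ (1 / sX)) ×ˢ indexBall dY ((r / R) ^ (1 / sY)) with hF
  have hcard : (F.card : ℝ) ≤ 2 ^ (dX + dY) * (n * R ^ 2) ^ 2 := by
    rw [← hT, hds]
    exact card_indexBall_prod_le hT0
  obtain ⟨e⟩ := exists_blockEmbedding (m := n / 4) (n := n) (by omega)
  refine testingRisk_le bX bY hβ.le (signFlipTest_mem_validTests
    (measurable_contrastVector bX bY F) (contrastVector_swapSnd bX bY F) hα e) ?_
  rintro f ⟨hf, hD, hS, hsup⟩
  have hfA := abs_le_of_supNorm_le hA.le ((le_max_left _ _).trans hsup)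
  have hX := abs_le_of_supNorm_le hA.le
    (((le_max_left _ _).trans (le_max_right _ _)).trans hsup)
  have hY := abs_le_of_supNorm_le hA.le
    (((le_max_right _ _).trans (le_max_right _ _)).trans hsup)
  have htrunc := dependence_le_truncation_add bX bY hf hX hY hS hT0 F
    (le_sobolevWeight hsX hsY hT0.le)
  have hRr : r ^ 2 / (r / R) ^ 2 = R ^ 2 := by field_simp
  rw [hRr] at htrunc
  rw [mul_pow, Real.sq_sqrt (by linarith)] at hD
  have hR2 : 0 < R ^ 2 := by positivity
  have hΔ : K * R ^ 2 / 2 ≤ ∑ a ∈ F, interaction bX bY f a ^ 2 := by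
    nlinarith
  -- Rounding in `n / 4` costs at most a factor `2`; with the halved signal this gives the `16` in
  -- `errorBound_le`.
  have hm : (n : ℝ) / 8 ≤ (n / 4 : ℕ) := by
    have : n ≤ 8 * (n / 4) := by omega
    have : (n : ℝ) ≤ 8 * (n / 4 : ℕ) := by exact_mod_cast this
    linarith
  refine (expect_one_sub_signFlipTest_contrastVector_le bX bY hα hA.le hf hfA hX hY F
    (lt_of_lt_of_le (by positivity) hΔ) (by omega) e).trans ?_
  refine errorBound_le (K := K) hκ0.le hB0.le (by positivity) hβ (by linarith) (by linarith) hx ?_ hcard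
  calc K * (n * R ^ 2) / 16 = (n / 8) * (K * R ^ 2 / 2) := by ring
    _ ≤ _ := by gcongr
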